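/- A monic polynomial $f(x)\in\mathbb Z[x]$ of degree $N$ is called monogenic if it is irreducible over $\mathbb Q$ and $\{1,\theta,\dots,\theta^{N-1}\}$ is a $\mathbb Z$-basis of the ring of integers of $\mathbb Q(\theta)$, where $f(\theta)=0$. Write $\mathrm{Gal}(f)$ for the Galois group over $\mathbb Q$ of the splitting field of $f$, and let 4T2, 4T3, 4T4, 4T5 denote the groups $C_2\times C_2$, $D_4$ (of order $8$), $A_4$, $S_4$, respectively. An infinite set of monogenic quartics is called an infinite family if distinct members generate distinct (non-isomorphic) quartic fields $\mathbb Q(\theta)$. **Theorem 1.1.** * **X=2.** For $t\in\mathbb Z$ let $f_t(x)=x^4+4tx^2+1$. Then 1. for every $t\in\mathbb Z$, $f_t(x)$ is irreducible over $\mathbb Q$ and $\mathrm{Gal}(f_t)\simeq$ 4T2; 2. for every $t\in\mathbb Z$, $f_t(x)$ is monogenic if and only if $(2t-1)(2t+1)$ is squarefree; 3. $\{f_t(x): t\in\mathbb Z,\ 4t^2-1\text{ is squarefree}\}$ is an infinite family of monogenic quartics with Galois group 4T2. * **X=3.** For $t\in\mathbb Z$ let $f_t(x)=x^4+24tx^3+(12t+4)x^2+4x+1$.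 Then 1. for every $t\in\mathbb Z$, $f_t(x)$ is irreducible over $\mathbb Q$ and $\mathrm{Gal}(f_t)\simeq$ 4T3; 2. for every $t\in\mathbb Z$, $f_t(x)$ is monogenic if and only if $(6t-1)(6t+1)$ is squarefree; 3. $\{f_t(x): t\in\mathbb Z,\ 36t^2-1\text{ is squarefree}\}$ is an infinite family of monogenic quartics with Galois group 4T3. * **X=4.** For $t\in\mathbb Z$ let $f_t(x)=x^4+2x^3+2x^2+4tx+36t^2-16t+2$. Then 1. for every $t\in\mathbb Z$, $f_t(x)$ is irreducible over $\mathbb Q$ and $\mathrm{Gal}(f_t)\simeq$ 4T4; 2. for every $t\in\mathbb Z$, $f_t(x)$ is monogenic if and only if $(4t-1)(108t^2-54t+7)$ is squarefree; 3. $\{f_t(x): t\in\mathbb Z,\ (4t-1)(108t^2-54t+7)\text{ is squarefree}\}$ is an infinite family of monogenic quartics with Galois group 4T4. * **X=5.** For $t\in\mathbb Z$ let $f_t(x)=x^4-2x^3-2x^2+6x+4t-2$. Then 1. for every $t\in\mathbb Z$, $f_t(x)$ is irreducible over $\mathbb Q$ and $\mathrm{Gal}(f_t)\simeq$ 4T5;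 2. for every $t\in\mathbb Z$, $f_t(x)$ is monogenic if and only if each of $4t+1$, $4t-7$ and $64t+13$ is squarefree; 3. $\{f_t(x): t\in\mathbb Z,\ 4t+1,\ 4t-7\text{ and }64t+13\text{ are squarefree}\}$ is an infinite family of monogenic quartics with Galois group 4T5. In each case, distinct values of $t$ satisfying the squarefreeness condition in 3 give non-isomorphic fields. -/

import Mathlib

open Polynomial IntermediateField

/-- The Galois group over `ℚ` of an integer polynomial (of a splitting field of it over `ℚ`). -/
abbrev GaloisGroupOverQ (f : ℤ[X]) : Type :=
  (f.map (Int.castRingHom ℚ)).Gal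

/-- A monic `f ∈ ℤ[X]` is monogenic if it is irreducible over `ℚ` and, for a root `θ` of `f`, the
powers `1, θ, …, θ ^ (deg f - 1)` form a `ℤ`-basis of the ring of integers of `ℚ(θ)`.
(All roots are conjugate, so it does not matter that the condition is asked for every root.) -/
def IsMonogenicPoly (f : ℤ[X]) : Prop :=
  f.Monic ∧ Irreducible (f.map (Int.castRingHom ℚ)) ∧
    ∀ θ : ℂ, aeval θ f = 0 →
      ∃ b : Module.Basis (Fin f.natDegree) ℤ (NumberField.RingOfIntegers ℚ⟮θ⟯),
        ∀ i, (((b i : NumberField.RingOfIntegers ℚ⟮θ⟯) : ℚ⟮θ⟯) : ℂ) = θ ^ (i : ℕ)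

/-- The polynomials `f` and `g` generate distinct fields: no field generated over `ℚ` by a root
of `f` is isomorphic to one generated by a root of `g`. In particular, these fields are distinct
as subfields of `ℂ`. -/
def GenerateDistinctFields (f g : ℤ[X]) : Prop :=
  ∀ α β : ℂ, aeval α f = 0 → aeval β g = 0 → IsEmpty (ℚ⟮α⟯ ≃+* ℚ⟮β⟯)

/-- The collection `{f t : t ∈ S}` is an infinite family of monogenic quartics with Galois group
isomorphic to `G`: it is an infinite set of polynomials, each of them is a monogenic quartic with
Galois group `G`, and distinct parameters in `S` give polynomials generating distinct fields. -/
def IsInfiniteFamilyOfMonogenicQuartics (G : Type) [Group G] (f : ℤ → ℤ[X]) (S : Set ℤ) : Prop :=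
  (f '' S).Infinite ∧
    (∀ t ∈ S, (f t).natDegree = 4 ∧ IsMonogenicPoly (f t) ∧
      Nonempty (GaloisGroupOverQ (f t) ≃* G)) ∧
    ∀ t₁ ∈ S, ∀ t₂ ∈ S, t₁ ≠ t₂ → GenerateDistinctFields (f t₁) (f t₂)

/-- The Klein four-group `C₂ × C₂` (4T2). -/
abbrev Group4T2 : Type := Multiplicative (ZMod 2) × Multiplicative (ZMod 2)

/-- The dihedral group of order `8` (4T3). -/
abbrev Group4T3 : Type := DihedralGroup 4

/-- The alternating group `A₄` (4T4). -/
abbrev Group4T4 : Type := alternatingGroup (Fin 4)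

/-- The symmetric group `S₄` (4T5). -/
abbrev Group4T5 : Type := Equiv.Perm (Fin 4)

/-- `x⁴ + 4 t x² + 1`. -/
noncomputable def quartic4T2 (t : ℤ) : ℤ[X] :=
  X ^ 4 + C (4 * t) * X ^ 2 + 1

/-- `x⁴ + 24 t x³ + (12 t + 4) x² + 4 x + 1`. -/
noncomputable def quartic4T3 (t : ℤ) : ℤ[X] :=
  X ^ 4 + C (24 * t) * X ^ 3 + C (12 * t + 4) * X ^ 2 + C 4 * X + 1

/-- `x⁴ + 2 x³ + 2 x² + 4 t x + 36 t² - 16 t + 2`. -/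
noncomputable def quartic4T4 (t : ℤ) : ℤ[X] :=
  X ^ 4 + C 2 * X ^ 3 + C 2 * X ^ 2 + C (4 * t) * X + C (36 * t ^ 2 - 16 * t + 2)

/-- `x⁴ - 2 x³ - 2 x² + 6 x + 4 t - 2`. -/
noncomputable def quartic4T5 (t : ℤ) : ℤ[X] :=
  X ^ 4 - C 2 * X ^ 3 - C 2 * X ^ 2 + C 6 * X + C (4 * t - 2)

/-! Monogenicity is decided by Uchida's form of Dedekind's criterion: `ℤ[θ] = ℤ[X]/(f)` is
integrally closed as soon as `f` lies in no `m ^ 2` with `m` maximal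
(`isMonogenicPoly_of_notMem_sq`). Conversely, `f = g²A + pgB + p²D` with `g`, `A` monic makes
`g(θ)A(θ)/p` an integer outside `ℤ[θ]` (`not_isMonogenicPoly`). If `f ∈ m ^ 2`, the image of `X` in
`ℤ[X]/m` is a double root of `f`, so some factor of the discriminant vanishes there. For each such
factor an explicit decomposition `s f = g²A + n g B + n u` with `g ∈ m` decides the question: when
`n ∈ m` is squarefree, `f ∈ m ^ 2` would force `u ∈ m`, and `u` is seen to be a unit at `m`.

Irreducibility is Eisenstein at `2`, if necessary after a shift. The Galois group is read off inside
`S₄` from its order, which is divisible by `4` always and by `3` if the resolvent cubic has no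
integral root, and from the square class of the discriminant, whose square root is multiplied by the
sign of a permutation. For `D₄` the resolvent has an integral root `β`, and the classes of `β² -
4d`, of the discriminant and of their product must all be nontrivial. For `C₂ × C₂` the roots are
`±θ, ±θ⁻¹`.

The parameter sets are infinite by a sieve: `∑ 1/p² ≤ 1/4` over odd primes, multiplied by at most
three residue classes modulo `p²`, removes at most `3/4` of the integers up to `N`, and the error is
controlled by Chebyshev's bound `π(cN) = o(N)`. The discriminant of a monogenic polynomial is that
of its field, so isomorphic fields have equal polynomial discriminants; this determines `t`, except
for `±t` in the `C₂ × C₂` family, where real and non-real fields are compared. -/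

/-! ### Maximal ideals of `ℤ[X]` and Dedekind's criterion. -/

/-- A maximal ideal of `ℤ[X]` containing a monic polynomial is generated by a prime number and a
polynomial. -/
theorem exists_maximal_eq_span_pair {f : ℤ[X]} (hf : f.Monic) (m : Ideal ℤ[X]) [hm : m.IsMaximal]
    (hfm : f ∈ m) :
    ∃ p : ℤ, Prime p ∧ ∃ g : ℤ[X], m = Ideal.span {C p, g} := by
  have hI : (m.comap (C : ℤ →+* ℤ[X])).IsMaximal := by
    have : (⊥ : Ideal (ℤ[X] ⧸ m)).IsMaximal := Ideal.bot_quotient_isMaximal_iff m |>.2 hm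
    have h := Ideal.isMaximal_comap_of_isIntegral_of_isMaximal'
      ((Ideal.Quotient.mk m).comp (algebraMap ℤ ℤ[X])) (hf.quotient_isIntegral hfm) ⊥
    rwa [← Ideal.comap_comap, ← RingHom.ker_eq_comap_bot, Ideal.mk_ker] at h
  set I := m.comap (C : ℤ →+* ℤ[X]) with hIdef
  have hI0 : I ≠ ⊥ := Ring.ne_bot_of_isMaximal_of_not_isField hI Int.not_isField
  obtain ⟨p, hp⟩ : ∃ p, I = Ideal.span {p} := (IsPrincipalIdealRing.principal I).principal
  have hp0 : p ≠ 0 := fun h => hI0 (by rw [hp, h]; simp)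
  have hpp : Prime p := (Ideal.span_singleton_prime hp0).1 (hp ▸ hI.isPrime)
  refine ⟨p, hpp, ?_⟩
  let _ := Ideal.Quotient.field I
  have hsurj : Function.Surjective (mapRingHom (Ideal.Quotient.mk I)) :=
    Polynomial.map_surjective _ Ideal.Quotient.mk_surjective
  obtain ⟨G, hG⟩ : ∃ G, m.map (mapRingHom (Ideal.Quotient.mk I)) = Ideal.span {G} :=
    (IsPrincipalIdealRing.principal _).principal
  have hker : RingHom.ker (mapRingHom (Ideal.Quotient.mk I)) = Ideal.span {C p} := by
    rw [ker_mapRingHom, Ideal.mk_ker, hp, Ideal.map_span, Set.image_singleton]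
  have hpm : C p ∈ m := by
    have : p ∈ I := hp ▸ Ideal.mem_span_singleton_self p
    exact this
  have hGm : G ∈ m.map (mapRingHom (Ideal.Quotient.mk I)) :=
    hG ▸ Ideal.mem_span_singleton_self G
  obtain ⟨g, hgm, rfl⟩ := (Ideal.mem_map_iff_of_surjective _ hsurj).1 hGm
  refine ⟨g, le_antisymm (fun x hx => ?_) ?_⟩
  · have hx' := Ideal.mem_map_of_mem (mapRingHom (Ideal.Quotient.mk I)) hx
    rw [hG, Ideal.mem_span_singleton] at hx'
    obtain ⟨H, hH⟩ := hx'
    obtain ⟨h, rfl⟩ := hsurj H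
    have : x - g * h ∈ Ideal.span {C p} := by
      rw [← hker, RingHom.mem_ker, map_sub, map_mul, hH, sub_self]
    obtain ⟨c, hc⟩ := Ideal.mem_span_singleton.1 this
    exact Ideal.mem_span_pair.2 ⟨c, h, by linear_combination -hc⟩
  · rw [Ideal.span_le]
    rintro x (rfl | rfl)
    · exact hpm
    · exact hgm

theorem mem_span_pair_sq {R : Type*} [CommRing R] {a b x : R} (h : x ∈ Ideal.span {a, b} ^ 2) :
    ∃ u v w, x = a * a * u + a * b * v + b * b * w := by
  rw [sq, Ideal.span_pair_mul_span_pair] at h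
  rw [Ideal.mem_span_insert] at h
  obtain ⟨u, z, hz, rfl⟩ := h
  rw [Ideal.mem_span_insert] at hz
  obtain ⟨v, z, hz, rfl⟩ := hz
  obtain ⟨w, c, rfl⟩ := Ideal.mem_span_pair.1 hz
  exact ⟨u, v + w, c, by ring⟩

/-- A squarefree integer has order at most one at every maximal ideal of `ℤ[X]` which contains a
monic polynomial. -/
theorem C_mul_notMem_sq {f : ℤ[X]} (hf : f.Monic) {m : Ideal ℤ[X]} (hm : m.IsMaximal)
    (hfm : f ∈ m) {n : ℤ} (hn : Squarefree n) {u : ℤ[X]} (hu : u ∉ m) : C n * u ∉ m ^ 2 := by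
  intro h
  obtain ⟨p, hp, g, hpg⟩ := exists_maximal_eq_span_pair hf m hfm
  have hpm : C p ∈ m := hpg ▸ Ideal.subset_span (by simp)
  have hint : ∀ k : ℤ, C k ∈ m → p ∣ k := by
    intro k hk
    by_contra hpk
    obtain ⟨a, b, hab⟩ := (Prime.coprime_iff_not_dvd hp).2 hpk
    apply hm.ne_top
    rw [Ideal.eq_top_iff_one]
    have : (1 : ℤ[X]) = C a * C p + C b * C k := by rw [← C_mul, ← C_mul, ← C_add, hab, C_1]
    rw [this]
    exact m.add_mem (m.mul_mem_left _ hpm) (m.mul_mem_left _ hk)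
  obtain ⟨k, rfl⟩ := hint n ((hm.isPrime.mem_or_mem (Ideal.pow_le_self two_ne_zero h)).resolve_right hu)
  have hk : C k ∉ m := fun hk => by
    obtain ⟨l, rfl⟩ := hint k hk
    exact hp.not_isUnit (hn p ⟨l, by ring⟩)
  rw [hpg] at h
  obtain ⟨A, B, D, h⟩ := mem_span_pair_sq h
  have hpC : Prime (C p : ℤ[X]) := Polynomial.prime_C_iff.2 hp
  -- Every other term of `p k u = p²A + p g B + g²D` is divisible by `p`, and `p ∤ g` because `f` is
  -- monic. So `D = pE`, and cancelling `p` puts `k u` in `m`.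
  have hd : C p ∣ g * g * D := ⟨C k * u - C p * A - g * B, by rw [C_mul] at h; linear_combination -h⟩
  have hg : ¬ C p ∣ g := by
    rintro ⟨c, rfl⟩
    rw [hpg, Ideal.mem_span_pair] at hfm
    obtain ⟨a, b, hab⟩ := hfm
    have h1 : C p ∣ f := ⟨a + b * c, by rw [← hab]; ring⟩
    rw [C_dvd_iff_dvd_coeff] at h1
    have := h1 f.natDegree
    rw [coeff_natDegree, hf.leadingCoeff] at this
    exact hp.not_isUnit (isUnit_of_dvd_one this)
  obtain ⟨E, rfl⟩ := (hpC.dvd_or_dvd hd).resolve_left fun h =>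
    hg ((hpC.dvd_or_dvd h).elim id id)
  have h2 : C k * u = C p * A + g * B + g * g * E := by
    apply mul_left_cancel₀ hpC.ne_zero
    rw [C_mul] at h
    linear_combination h
  have : C k * u ∈ m := by
    rw [hpg, Ideal.mem_span_pair]
    exact ⟨A, B + g * E, by rw [h2]; ring⟩
  exact (hm.isPrime.mem_or_mem this).elim hk hu

/-- The Leibniz rule. This is what makes the image of `X` in the residue field a double root. -/
theorem derivative_mem_of_mem_sq {m : Ideal ℤ[X]} {f : ℤ[X]} (h : f ∈ m ^ 2) :
    derivative f ∈ m := by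
  rw [sq] at h
  refine Submodule.mul_induction_on h (fun a ha b hb => ?_) fun a b ha hb => ?_
  · rw [derivative_mul]
    exact m.add_mem (m.mul_mem_left _ hb) (m.mul_mem_right _ ha)
  · rw [derivative_add]
    exact m.add_mem ha hb

/-- Being integrally closed is local. With `m = (p, g)` and `f = u p + v g`, the hypothesis `f ∉ m ^
2` says that `u` or `v` is a unit at `m`. In the local ring of `ℤ[X]/(f)` the relation `u p + v g =
0` then eliminates one generator, so the maximal ideal is principal. -/
theorem isIntegrallyClosed_adjoinRoot {f : ℤ[X]} (hf : f.Monic) (hirr : Irreducible f)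
    (h : ∀ m : Ideal ℤ[X], m.IsMaximal → f ∈ m → f ∉ m ^ 2) :
    IsIntegrallyClosed (AdjoinRoot f) := by
  have : IsDomain (AdjoinRoot f) := AdjoinRoot.isDomain_of_prime hirr.prime
  have : IsNoetherianRing (AdjoinRoot f) := Ideal.Quotient.isNoetherianRing _
  refine IsIntegrallyClosed.of_localization_maximal fun P _ hP => ?_
  let m := P.comap (AdjoinRoot.mk f)
  have hsurj : Function.Surjective (AdjoinRoot.mk f) := AdjoinRoot.mk_surjective
  have hm : m.IsMaximal := Ideal.comap_isMaximal_of_surjective _ hsurj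
  have hfm : f ∈ m := by simp [m, Ideal.mem_comap]
  obtain ⟨p, hp, g, hpg⟩ := exists_maximal_eq_span_pair hf m hfm
  let φ : ℤ[X] →+* Localization.AtPrime P := (algebraMap _ _).comp (AdjoinRoot.mk f)
  have hunit : ∀ u, u ∉ m → IsUnit (φ u) := fun u hu =>
    IsLocalization.map_units (Localization.AtPrime P) (⟨AdjoinRoot.mk f u, hu⟩ : P.primeCompl)
  have hmP : Ideal.map (algebraMap (AdjoinRoot f) (Localization.AtPrime P))
      (m.map (AdjoinRoot.mk f)) = Ideal.map (algebraMap _ (Localization.AtPrime P)) P :=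
    congrArg _ (Ideal.map_comap_of_surjective _ hsurj P)
  have hmax : IsLocalRing.maximalIdeal (Localization.AtPrime P) = Ideal.span {φ (C p), φ g} := by
    rw [← Localization.AtPrime.map_eq_maximalIdeal,
      ← hmP, Ideal.map_map, hpg, Ideal.map_span, Set.image_pair]
  obtain ⟨u, v, huv⟩ := Ideal.mem_span_pair.1 (hpg ▸ hfm)
  have h0 : φ u * φ (C p) + φ v * φ g = 0 := by
    rw [← map_mul, ← map_mul, ← map_add, huv]
    simp [φ]
  have hpr : (IsLocalRing.maximalIdeal (Localization.AtPrime P)).IsPrincipal := by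
    rw [hmax]
    by_cases hu : u ∈ m
    · by_cases hv : v ∈ m
      · refine absurd ?_ (h m hm hfm)
        rw [← huv, sq]
        have hpm : C p ∈ m := hpg ▸ Ideal.subset_span (by simp)
        have hgm : g ∈ m := hpg ▸ Ideal.subset_span (by simp)
        exact Ideal.add_mem _ (Ideal.mul_mem_mul hu hpm) (Ideal.mul_mem_mul hv hgm)
      · obtain ⟨w, hw⟩ := (hunit v hv).exists_left_inv
        refine ⟨φ (C p), le_antisymm ?_ ?_⟩
        · rw [Ideal.span_le]
          rintro x (rfl | rfl)
          · exact Ideal.mem_span_singleton_self _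
          · exact Ideal.mem_span_singleton.2 ⟨-(w * φ u), by
              linear_combination w * h0 - φ g * hw⟩
        · exact Ideal.span_mono (by simp)
    · obtain ⟨w, hw⟩ := (hunit u hu).exists_left_inv
      refine ⟨φ g, le_antisymm ?_ ?_⟩
      · rw [Ideal.span_le]
        rintro x (rfl | rfl)
        · exact Ideal.mem_span_singleton.2 ⟨-(w * φ v), by
            linear_combination w * h0 - φ (C p) * hw⟩
        · exact Ideal.mem_span_singleton_self _
      · exact Ideal.span_mono (by simp)
  have := ((tfae_of_isNoetherianRing_of_isLocalRing_of_isDomain (Localization.AtPrime P)).out 4 3).1 hpr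
  exact this.1

theorem minpoly_int_eq {K : Type*} [Field K] [CharZero K] {f : ℤ[X]} (hf : f.Monic)
    (hirr : Irreducible (f.map (Int.castRingHom ℚ))) {x : K} (hx : aeval x f = 0) :
    minpoly ℤ x = f := by
  have hi : IsIntegral ℤ x := ⟨f, hf, by rwa [← aeval_def]⟩
  have h1 : f.map (Int.castRingHom ℚ) = minpoly ℚ x :=
    minpoly.eq_of_irreducible_of_monic hirr
      (by rw [← algebraMap_int_eq, aeval_map_algebraMap, hx]) (hf.map _)
  rw [minpoly.isIntegrallyClosed_eq_field_fractions' ℚ hi, algebraMap_int_eq] at h1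
  exact (map_injective _ (RingHom.injective_int (Int.castRingHom ℚ)) h1).symm

theorem aeval_gen_eq_zero {f : ℤ[X]} {θ : ℂ} (hθ : aeval θ f = 0) :
    aeval (AdjoinSimple.gen ℚ θ) f = 0 := by
  apply (algebraMap ℚ⟮θ⟯ ℂ).injective
  rw [← aeval_algebraMap_apply, AdjoinSimple.algebraMap_gen, hθ, map_zero]

theorem isIntegral_of_monic_aeval {f : ℤ[X]} (hf : f.Monic) {θ : ℂ} (hθ : aeval θ f = 0) :
    IsIntegral ℚ θ := by
  have : IsIntegral ℤ θ := ⟨f, hf, by rwa [← aeval_def]⟩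
  exact this.tower_top

theorem numberField_adjoin_simple {f : ℤ[X]} (hf : f.Monic) {θ : ℂ} (hθ : aeval θ f = 0) :
    NumberField ℚ⟮θ⟯ := by
  have := adjoin.finiteDimensional (isIntegral_of_monic_aeval hf hθ)
  exact ⟨⟩

/-- If `f` does not lie in the square of any maximal ideal of `ℤ[X]`, it is monogenic. -/
theorem isMonogenicPoly_of_notMem_sq {f : ℤ[X]} (hf : f.Monic)
    (hirr : Irreducible (f.map (Int.castRingHom ℚ)))
    (h : ∀ m : Ideal ℤ[X], m.IsMaximal → f ∈ m → f ∉ m ^ 2) : IsMonogenicPoly f := by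
  refine ⟨hf, hirr, fun θ hθ => ?_⟩
  have := numberField_adjoin_simple hf hθ
  have hirr' : Irreducible f := (Monic.irreducible_iff_irreducible_map_fraction_map hf).2 hirr
  have hgen := aeval_gen_eq_zero hθ
  have hgi : IsIntegral ℤ (AdjoinSimple.gen ℚ θ) := ⟨f, hf, by rwa [← aeval_def]⟩
  let x : NumberField.RingOfIntegers ℚ⟮θ⟯ := ⟨AdjoinSimple.gen ℚ θ, hgi⟩
  have hmx : minpoly ℤ x = f := by
    rw [← minpoly_int_eq hf hirr hgen]
    exact (minpoly.algebraMap_eq (B' := ℚ⟮θ⟯)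
      (FaithfulSMul.algebraMap_injective (NumberField.RingOfIntegers ℚ⟮θ⟯) ℚ⟮θ⟯) x).symm
  have hxi : IsIntegral ℤ x := NumberField.RingOfIntegers.isIntegral x
  have htop : Algebra.adjoin ℤ {x} = ⊤ := by
    have : IsIntegrallyClosed (AdjoinRoot (minpoly ℤ x)) := by
      rw [hmx]
      exact isIntegrallyClosed_adjoinRoot hf hirr' h
    have : IsIntegrallyClosed (Algebra.adjoin ℤ {x}) :=
      IsIntegrallyClosed.of_equiv (minpoly.equivAdjoin hxi).toRingEquiv
    have hx : x ∈ Algebra.adjoin ℤ {x} := Algebra.self_mem_adjoin_singleton ℤ x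
    -- An element of `ℚ(θ)` is a rational polynomial in `θ`; clearing denominators makes it a
    -- quotient of an element of `ℤ[θ]` by an integer.
    have : IsFractionRing (Algebra.adjoin ℤ {x}) ℚ⟮θ⟯ := by
      refine IsFractionRing.of_field _ _ fun z => ?_
      obtain ⟨q, hq⟩ :=
        (adjoin.powerBasis (isIntegral_of_monic_aeval hf hθ)).exists_eq_aeval' z
      obtain ⟨n, hn0, hn⟩ := IsLocalization.integerNormalization_spec (nonZeroDivisors ℤ) q
      refine ⟨aeval ⟨x, hx⟩ (IsLocalization.integerNormalization (nonZeroDivisors ℤ) q),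
        algebraMap ℤ _ n, ?_⟩
      have hgx : algebraMap (Algebra.adjoin ℤ {x}) ℚ⟮θ⟯ ⟨x, hx⟩ = AdjoinSimple.gen ℚ θ := rfl
      have hnz : (algebraMap (Algebra.adjoin ℤ {x}) ℚ⟮θ⟯) (algebraMap ℤ _ n) = n := by simp
      rw [eq_div_iff, hq, adjoin.powerBasis_gen, ← aeval_algebraMap_apply, hgx,
        ← aeval_map_algebraMap ℚ (AdjoinSimple.gen ℚ θ)
          (IsLocalization.integerNormalization (nonZeroDivisors ℤ) q), hn, hnz, map_zsmul,
        zsmul_eq_mul, mul_comm]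
      · rfl
      rw [hnz]
      exact_mod_cast nonZeroDivisors.ne_zero hn0
    rw [eq_top_iff]
    intro y _
    have hy : IsIntegral (Algebra.adjoin ℤ {x}) (algebraMap _ ℚ⟮θ⟯ y) :=
      (NumberField.RingOfIntegers.isIntegral_coe y).tower_top
    obtain ⟨w, hw⟩ := IsIntegrallyClosed.isIntegral_iff.1 hy
    have : (w : NumberField.RingOfIntegers ℚ⟮θ⟯) = y :=
      FaithfulSMul.algebraMap_injective (NumberField.RingOfIntegers ℚ⟮θ⟯) ℚ⟮θ⟯ hw
    exact this ▸ w.2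
  let pb := PowerBasis.ofAdjoinEqTop' hxi htop
  have hdim : pb.dim = f.natDegree := by
    rw [PowerBasis.ofAdjoinEqTop'_dim, hmx]
  refine ⟨pb.basis.reindex (finCongr hdim), fun i => ?_⟩
  rw [Module.Basis.reindex_apply, pb.basis_eq_pow, PowerBasis.ofAdjoinEqTop'_gen]
  exact congrArg ((↑) : ℚ⟮θ⟯ → ℂ) (map_pow (algebraMap (NumberField.RingOfIntegers ℚ⟮θ⟯) ℚ⟮θ⟯) x i)

theorem isIntegral_of_sq_add_mul_add {R S : Type*} [CommRing R] [CommRing S] [Algebra R S]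
    {x b c : S} (hb : IsIntegral R b) (hc : IsIntegral R c) (h : x ^ 2 + b * x + c = 0) :
    IsIntegral R x := by
  nontriviality S
  let A := integralClosure R S
  have : IsIntegral A x := by
    refine ⟨X ^ 2 + C (⟨b, hb⟩ : A) * X + C (⟨c, hc⟩ : A), by monicity!, ?_⟩
    simp only [eval₂_add, eval₂_mul, eval₂_pow, eval₂_X, eval₂_C]
    exact h
  exact isIntegral_trans x this

/-- The failure of Dedekind's criterion at `p`: if `f` lies in the square of the ideal `(p, g)`,
then `f` is not monogenic. -/
theorem not_isMonogenicPoly {f g A B D : ℤ[X]} {p : ℤ} (hp : ¬ IsUnit p) (hp0 : p ≠ 0)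
    (hA : A.Monic) (hg : g.Monic) (hdeg : (g * A).natDegree < f.natDegree)
    (h : f = g * g * A + C p * g * B + C p * C p * D) : ¬ IsMonogenicPoly f := by
  rintro ⟨hf, hirr, hbasis⟩
  obtain ⟨θ, hθ⟩ : ∃ θ : ℂ, aeval θ f = 0 :=
    IsAlgClosed.exists_aeval_eq_zero ℂ f (by
      rw [degree_eq_natDegree hf.ne_zero]
      exact_mod_cast (by lia : f.natDegree ≠ 0))
  obtain ⟨b, hb⟩ := hbasis θ hθ
  have := numberField_adjoin_simple hf hθ
  have hgen := aeval_gen_eq_zero hθ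
  set η := AdjoinSimple.gen ℚ θ with hη
  have hηi : IsIntegral ℤ η := ⟨f, hf, by rwa [← aeval_def]⟩
  have hi : ∀ q : ℤ[X], IsIntegral ℤ (aeval η q) := fun q => by
    have := Subalgebra.aeval_coe (integralClosure ℤ ℚ⟮θ⟯) ⟨η, hηi⟩ q
    exact this ▸ Subtype.prop _
  have hpK : (p : ℚ⟮θ⟯) ≠ 0 := by exact_mod_cast hp0
  -- Multiplying `f(η) = 0` by `A(η)/p²` gives `y² + B(η) y + A(η)D(η) = 0` for `y = g(η)A(η)/p`.
  have hx : IsIntegral ℤ (aeval η (g * A) / (p : ℚ⟮θ⟯)) := by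
    refine isIntegral_of_sq_add_mul_add (hi B) (hi (A * D)) ?_
    rw [h] at hgen
    simp only [map_add, map_mul, eq_intCast, map_intCast] at hgen ⊢
    field_simp
    linear_combination (aeval η A) * hgen
  let y : NumberField.RingOfIntegers ℚ⟮θ⟯ := ⟨_, hx⟩
  have hy := b.sum_repr y
  let q : ℤ[X] := ∑ i, C (b.repr y i) * X ^ (i : ℕ)
  have hq : aeval θ q = ((y : ℚ⟮θ⟯) : ℂ) := by
    rw [← hy]
    simp [q, map_sum, hb]
  have hq' : aeval θ (g * A - C p * q) = 0 := by
    have hyc : ((y : ℚ⟮θ⟯) : ℂ) = aeval θ (g * A) / p := by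
      change algebraMap ℚ⟮θ⟯ ℂ (aeval η (g * A) / (p : ℚ⟮θ⟯)) = _
      rw [map_div₀, ← aeval_algebraMap_apply, hη, AdjoinSimple.algebraMap_gen]
      simp
    rw [map_sub, map_mul (aeval θ) (C p), hq, hyc, aeval_C]
    have : (p : ℂ) ≠ 0 := by exact_mod_cast hp0
    simp only [algebraMap_int_eq, eq_intCast]
    field_simp
    ring
  have hqd : q.degree < f.natDegree := by
    refine (degree_sum_le _ _).trans_lt ?_
    rw [Finset.sup_lt_iff (by exact WithBot.bot_lt_coe _)]
    intro i _
    exact (degree_C_mul_X_pow_le _ _).trans_lt (by exact_mod_cast i.2)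
  -- This polynomial kills `θ` and has degree below that of the minimal polynomial `f`. Hence `p`
  -- would divide the monic polynomial `gA`.
  have hz : g * A - C p * q = 0 := by
    by_contra hne
    have h1 := minpoly.IsIntegrallyClosed.degree_le_of_ne_zero (R := ℤ) (s := θ) hne hq'
    rw [minpoly_int_eq hf hirr hθ, degree_eq_natDegree hf.ne_zero] at h1
    refine absurd h1 (not_le.2 ((degree_sub_le _ _).trans_lt (max_lt ?_ ?_)))
    · exact degree_le_natDegree.trans_lt (by exact_mod_cast hdeg)
    · rw [← smul_eq_C_mul]
      exact (degree_smul_le _ _).trans_lt hqd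
  have hd : C p ∣ g * A := ⟨q, sub_eq_zero.1 hz⟩
  have := (C_dvd_iff_dvd_coeff _ _).1 hd (g * A).natDegree
  rw [coeff_natDegree, (hg.mul hA).leadingCoeff] at this
  exact hp (isUnit_of_dvd_one this)

/-- A polynomial with a double root modulo `p` that is a root modulo `p ^ 2` is not monogenic. -/
theorem not_isMonogenicPoly_of_root {f A : ℤ[X]} {p r k l : ℤ} (hp : ¬ IsUnit p) (hp0 : p ≠ 0)
    (hA : A.Monic)
    (h : f = (X - C r) ^ 2 * A + C (p * k) * (X - C r) + C (p ^ 2 * l)) :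
    ¬ IsMonogenicPoly f := by
  have hdl : ((X - C r) ^ 2 * A).natDegree = 2 + A.natDegree := by
    rw [((monic_X_sub_C r).pow 2).natDegree_mul hA, (monic_X_sub_C r).natDegree_pow,
      natDegree_X_sub_C]
  have hd : f.natDegree = 2 + A.natDegree := by
    rw [h, add_assoc, natDegree_add_eq_left_of_natDegree_lt, hdl]
    rw [hdl]
    refine lt_of_le_of_lt ?_ (by lia : 1 < 2 + A.natDegree)
    compute_degree
  refine not_isMonogenicPoly hp hp0 hA (monic_X_sub_C r) (B := C k) (D := C l) ?_ ?_
  · rw [(monic_X_sub_C r).natDegree_mul hA, natDegree_X_sub_C, hd]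
    lia
  · rw [h]
    simp only [C_mul, C_pow]
    ring

/-! ### Roots and discriminant of a quartic. -/

/-- The quartic `x⁴ + a x³ + b x² + c x + d`. -/
noncomputable def quartic (a b c d : ℤ) : ℤ[X] :=
  X ^ 4 + C a * X ^ 3 + C b * X ^ 2 + C c * X + C d

/-- The discriminant of `x⁴ + a x³ + b x² + c x + d`. -/
def quarticDisc {R : Type*} [CommRing R] (a b c d : R) : R :=
  256 * d ^ 3 - 192 * a * c * d ^ 2 - 128 * b ^ 2 * d ^ 2 + 144 * b * c ^ 2 * d - 27 * c ^ 4
    + 144 * a ^ 2 * b * d ^ 2 - 6 * a ^ 2 * c ^ 2 * d - 80 * a * b ^ 2 * c * d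
    + 18 * a * b * c ^ 3 + 16 * b ^ 4 * d - 4 * b ^ 3 * c ^ 2 - 27 * a ^ 4 * d ^ 2
    + 18 * a ^ 3 * b * c * d - 4 * a ^ 3 * c ^ 3 - 4 * a ^ 2 * b ^ 3 * d + a ^ 2 * b ^ 2 * c ^ 2

theorem quartic_monic (a b c d : ℤ) : (quartic a b c d).Monic := by
  unfold quartic; monicity!

theorem quartic_natDegree (a b c d : ℤ) : (quartic a b c d).natDegree = 4 := by
  unfold quartic; compute_degree!

theorem aeval_quartic {L : Type*} [Field L] [CharZero L] (a b c d : ℤ) (x : L) :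
    aeval x (quartic a b c d) = x ^ 4 + a * x ^ 3 + b * x ^ 2 + c * x + d := by
  simp [quartic]

theorem cubic_coeff_eq_zero {R : Type*} [CommRing R] {e₀ e₁ e₂ e₃ : R}
    (h : C e₃ * X ^ 3 + C e₂ * X ^ 2 + C e₁ * X + C e₀ = 0) :
    e₃ = 0 ∧ e₂ = 0 ∧ e₁ = 0 ∧ e₀ = 0 := by
  have h0 := congrArg (coeff · 0) h
  have h1 := congrArg (coeff · 1) h
  have h2 := congrArg (coeff · 2) h
  have h3 := congrArg (coeff · 3) h
  simp [coeff_X, coeff_C, coeff_X_pow] at h0 h1 h2 h3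
  exact ⟨h3, h2, h1, h0⟩

/-- Vieta's formulas for quartics with four distinct roots. -/
theorem quartic_vieta {L : Type*} [Field L] {a b c d : L} {x : Fin 4 → L}
    (hx : Function.Injective x)
    (h : ∀ i, x i ^ 4 + a * x i ^ 3 + b * x i ^ 2 + c * x i + d = 0) :
    a = -(x 0 + x 1 + x 2 + x 3) ∧
    b = x 0 * x 1 + x 0 * x 2 + x 0 * x 3 + x 1 * x 2 + x 1 * x 3 + x 2 * x 3 ∧
    c = -(x 0 * x 1 * x 2 + x 0 * x 1 * x 3 + x 0 * x 2 * x 3 + x 1 * x 2 * x 3) ∧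
    d = x 0 * x 1 * x 2 * x 3 := by
  classical
  -- `E` is the quartic minus `∏ (X - x i)`: a polynomial of degree at most three with four zeros.
  set E : L[X] := C (a + (x 0 + x 1 + x 2 + x 3)) * X ^ 3 +
    C (b - (x 0 * x 1 + x 0 * x 2 + x 0 * x 3 + x 1 * x 2 + x 1 * x 3 + x 2 * x 3)) * X ^ 2 +
    C (c + (x 0 * x 1 * x 2 + x 0 * x 1 * x 3 + x 0 * x 2 * x 3 + x 1 * x 2 * x 3)) * X +
    C (d - x 0 * x 1 * x 2 * x 3) with hE
  have hE0 : E = 0 := by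
    refine eq_zero_of_natDegree_lt_card_of_eval_eq_zero E hx (fun i => ?_) ?_
    · simp only [hE, eval_add, eval_mul, eval_C, eval_pow, eval_X]
      obtain rfl | rfl | rfl | rfl : i = 0 ∨ i = 1 ∨ i = 2 ∨ i = 3 := by lia
      · linear_combination h 0
      · linear_combination h 1
      · linear_combination h 2
      · linear_combination h 3
    · rw [Fintype.card_fin]
      refine lt_of_le_of_lt ?_ (by norm_num : 3 < 4)
      rw [hE]
      compute_degree
  obtain ⟨h3, h2, h1, h0⟩ := cubic_coeff_eq_zero (hE ▸ hE0)
  refine ⟨?_, ?_, ?_, ?_⟩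
  · linear_combination h3
  · linear_combination h2
  · linear_combination h1
  · linear_combination h0

theorem vandermonde_det_sq {L : Type*} [Field L] {a b c d : L} {x : Fin 4 → L}
    (hx : Function.Injective x)
    (h : ∀ i, x i ^ 4 + a * x i ^ 3 + b * x i ^ 2 + c * x i + d = 0) :
    (Matrix.vandermonde x).det ^ 2 = quarticDisc a b c d := by
  obtain ⟨rfl, rfl, rfl, rfl⟩ := quartic_vieta hx h
  have hd : (Matrix.vandermonde x).det =
      (x 1 - x 0) * (x 2 - x 0) * (x 3 - x 0) * ((x 2 - x 1) * (x 3 - x 1) * (x 3 - x 2)) := by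
    rw [Matrix.det_vandermonde]
    simp [Fin.prod_univ_four, show Finset.Ioi (0 : Fin 4) = {1, 2, 3} by decide,
      show Finset.Ioi (1 : Fin 4) = {2, 3} by decide, show Finset.Ioi (2 : Fin 4) = {3} by decide,
      show Finset.Ioi (3 : Fin 4) = ∅ by decide]
    ring
  rw [hd]
  unfold quarticDisc
  ring

/-! ### The Galois action on the four roots. -/

theorem nonempty_gal_mulEquiv {F : Type} [Field F] {p : F[X]} {G : Type} [Group G]
    (h : ∀ (L : Type) [Field L] [Algebra F L] [IsSplittingField F L p],
      Nonempty ((L ≃ₐ[F] L) ≃* G)) : Nonempty (p.Gal ≃* G) :=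
  h p.SplittingField

/-- The roots of an irreducible quartic over `ℚ`, and the action of its Galois group on them. -/
theorem exists_roots_and_action {F : Type*} [Field F] {p : F[X]} (hp : p.Separable)
    (hd : p.natDegree = 4)
    (L : Type*) [Field L] [Algebra F L] [IsSplittingField F L p] :
    ∃ (x : Fin 4 → L) (φ : (L ≃ₐ[F] L) →* Equiv.Perm (Fin 4)),
      Function.Injective x ∧ Function.Injective φ ∧ (∀ i, aeval (x i) p = 0) ∧
      ∀ (σ : L ≃ₐ[F] L) i, σ (x i) = x (φ σ i) := by
  classical
  have hp0 : p ≠ 0 := fun h => by simp [h] at hd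
  have hcard : Fintype.card (p.rootSet L) = 4 := by
    rw [card_rootSet_eq_natDegree hp (IsSplittingField.splits L p), hd]
  let e : Fin 4 ≃ p.rootSet L := (Fintype.equivFinOfCardEq hcard).symm
  have hmem : ∀ (σ : L ≃ₐ[F] L) i, σ (e i) ∈ p.rootSet L := fun σ i => by
    rw [mem_rootSet_of_ne hp0]
    have := aeval_eq_zero_of_mem_rootSet (e i).2
    rw [← AlgEquiv.coe_toAlgHom, aeval_algHom_apply, this, map_zero]
  let g : (L ≃ₐ[F] L) → Fin 4 → Fin 4 := fun σ i => e.symm ⟨σ (e i), hmem σ i⟩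
  have hg : ∀ σ i, σ (e i) = e (g σ i) := fun σ i => by simp [g]
  have hmul : ∀ σ τ i, g (σ * τ) i = g σ (g τ i) := fun σ τ i => by
    apply e.injective
    apply Subtype.ext
    rw [← hg, ← hg, ← hg, AlgEquiv.mul_apply]
  have hone : ∀ i, g 1 i = i := fun i => by
    apply e.injective
    apply Subtype.ext
    rw [← hg, AlgEquiv.one_apply]
  let φ : (L ≃ₐ[F] L) →* Equiv.Perm (Fin 4) :=
    { toFun := fun σ => ⟨g σ, g σ⁻¹, fun i => by rw [← hmul, inv_mul_cancel, hone],
        fun i => by rw [← hmul, mul_inv_cancel, hone]⟩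
      map_one' := Equiv.ext hone
      map_mul' := fun σ τ => Equiv.ext (hmul σ τ) }
  refine ⟨fun i => e i, φ, Subtype.val_injective.comp e.injective, ?_,
    fun i => aeval_eq_zero_of_mem_rootSet (e i).2, hg⟩
  intro σ τ h
  have hgen := IsSplittingField.adjoin_rootSet L p
  have : (σ : L →ₐ[F] L) = τ := by
    refine AlgHom.ext_of_adjoin_eq_top hgen fun y hy => ?_
    obtain ⟨i, hi⟩ := e.surjective ⟨y, hy⟩
    have hy' : y = e i := by rw [hi]
    have h1 : g σ i = g τ i := congrArg (fun π : Equiv.Perm (Fin 4) => π i) h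
    rw [hy', AlgEquiv.coe_toAlgHom, AlgEquiv.coe_toAlgHom, hg, hg, h1]
  exact AlgEquiv.ext fun y => DFunLike.congr_fun this y

/-- Applying `σ` permutes the rows of the Vandermonde matrix. So the square root of the discriminant
carries the sign character. -/
theorem map_vandermonde_det {F L : Type*} [Field F] [Field L] [Algebra F L] (σ : L ≃ₐ[F] L)
    (x : Fin 4 → L) (π : Equiv.Perm (Fin 4)) (h : ∀ i, σ (x i) = x (π i)) :
    σ (Matrix.vandermonde x).det = (Equiv.Perm.sign π : ℤ) * (Matrix.vandermonde x).det := by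
  rw [← Matrix.det_permute, AlgEquiv.map_det]
  congr 1
  ext i j
  simp [Matrix.vandermonde_apply, h]

/-- The order of the group is `[L : F]`, a multiple of the degree of any element of `L`. It is used
for the quartic itself and for its resolvent cubic. -/
theorem natDegree_dvd_card_algEquiv {F : Type*} [Field F] {p q : F[X]} (hp : p.Separable)
    (hq : Irreducible q) (L : Type*) [Field L] [Algebra F L] [IsSplittingField F L p]
    {y : L} (hy : aeval y q = 0) : q.natDegree ∣ Nat.card (L ≃ₐ[F] L) := by
  have := IsSplittingField.finiteDimensional L p
  have : IsGalois F L := IsGalois.of_separable_splitting_field hp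
  rw [IsGalois.card_aut_eq_finrank]
  have h := minpoly.degree_dvd (K := F) (Algebra.IsIntegral.isIntegral (R := F) y)
  rwa [← minpoly.eq_of_irreducible hq hy, natDegree_mul_C] at h
  exact inv_ne_zero (leadingCoeff_ne_zero.2 hq.ne_zero)

/-- An integer with a square root that is fixed by the Galois group is a square. -/
theorem isSquare_of_fixed {p : ℚ[X]} (hp : p.Separable) {L : Type*} [Field L]
    [Algebra ℚ L] [IsSplittingField ℚ L p] {y : L} {n : ℤ}
    (hy : y ^ 2 = n) (h : ∀ σ : L ≃ₐ[ℚ] L, σ y = y) : IsSquare n := by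
  have := IsSplittingField.finiteDimensional L p
  have : IsGalois ℚ L := IsGalois.of_separable_splitting_field hp
  have := algebraRat.charZero L
  obtain ⟨r, rfl⟩ := (IsGalois.mem_range_algebraMap_iff_fixed y).2 h
  have hr : r ^ 2 = (n : ℚ) := by
    apply (algebraMap ℚ L).injective
    rw [map_pow, hy, map_intCast]
  rw [← Rat.isSquare_intCast_iff]
  exact ⟨r, by rw [← hr, sq]⟩

/-- The roots of an irreducible integral quartic in a splitting field. -/
theorem quartic_roots_and_action {a b c d : ℤ}
    (hirr : Irreducible ((quartic a b c d).map (Int.castRingHom ℚ)))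
    (L : Type*) [Field L] [Algebra ℚ L]
    [IsSplittingField ℚ L ((quartic a b c d).map (Int.castRingHom ℚ))] :
    ∃ (x : Fin 4 → L) (φ : (L ≃ₐ[ℚ] L) →* Equiv.Perm (Fin 4)),
      Function.Injective x ∧ Function.Injective φ ∧
      (∀ i, x i ^ 4 + a * x i ^ 3 + b * x i ^ 2 + c * x i + d = 0) ∧
      ∀ (σ : L ≃ₐ[ℚ] L) i, σ (x i) = x (φ σ i) := by
  have := algebraRat.charZero L
  obtain ⟨x, φ, hx, hφ, h, hact⟩ := exists_roots_and_action hirr.separable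
    (by rw [(quartic_monic a b c d).natDegree_map, quartic_natDegree]) L
  refine ⟨x, φ, hx, hφ, fun i => ?_, hact⟩
  have := h i
  simpa [quartic] using this

section

variable {a b c d : ℤ} {L : Type*} [Field L] [Algebra ℚ L]
  [IsSplittingField ℚ L ((quartic a b c d).map (Int.castRingHom ℚ))]

theorem four_dvd_card (hirr : Irreducible ((quartic a b c d).map (Int.castRingHom ℚ)))
    {x : L} (h : x ^ 4 + a * x ^ 3 + b * x ^ 2 + c * x + d = 0) :
    4 ∣ Nat.card (L ≃ₐ[ℚ] L) := by
  have hd : ((quartic a b c d).map (Int.castRingHom ℚ)).natDegree = 4 := by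
    rw [(quartic_monic a b c d).natDegree_map, quartic_natDegree]
  rw [← hd]
  refine natDegree_dvd_card_algEquiv hirr.separable hirr L (y := x) ?_
  simpa [quartic] using h

theorem monic_cubic_irreducible {u v w : ℤ} (h : ∀ y : ℤ, y ^ 3 + u * y ^ 2 + v * y + w ≠ 0) :
    Irreducible ((X ^ 3 + C u * X ^ 2 + C v * X + C w : ℤ[X]).map (Int.castRingHom ℚ)) := by
  have hm : (X ^ 3 + C u * X ^ 2 + C v * X + C w : ℤ[X]).Monic := by monicity!
  have hd : (X ^ 3 + C u * X ^ 2 + C v * X + C w : ℤ[X]).natDegree = 3 := by compute_degree!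
  have hd' := hm.natDegree_map (Int.castRingHom ℚ)
  rw [hd] at hd'
  rw [irreducible_iff_roots_eq_zero_of_degree_le_three (by lia) (by lia),
    Multiset.eq_zero_iff_forall_notMem]
  intro r hr
  rw [mem_roots (hm.map _).ne_zero, IsRoot.def, eval_map] at hr
  obtain ⟨y, rfl⟩ := isInteger_of_is_root_of_monic hm (A := ℤ) (K := ℚ) (r := r)
    (by rw [aeval_def, algebraMap_int_eq, hr])
  apply h y
  rw [← algebraMap_int_eq, eval₂_at_apply] at hr
  have := (algebraMap ℤ ℚ).injective_int (hr.trans (map_zero _).symm)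
  simpa using this

/-- If the resolvent cubic has no integral root, the order of the Galois group is divisible by
three. -/
theorem three_dvd_card (hirr : Irreducible ((quartic a b c d).map (Int.castRingHom ℚ)))
    (hres : ∀ y : ℤ, y ^ 3 + -b * y ^ 2 + (a * c - 4 * d) * y + -(a ^ 2 * d - 4 * b * d + c ^ 2) ≠ 0)
    {x : Fin 4 → L} (hx : Function.Injective x)
    (h : ∀ i, x i ^ 4 + a * x i ^ 3 + b * x i ^ 2 + c * x i + d = 0) :
    3 ∣ Nat.card (L ≃ₐ[ℚ] L) := by
  have := algebraRat.charZero L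
  obtain ⟨ha, hb, hc, hd⟩ := quartic_vieta hx h
  have hirr3 := monic_cubic_irreducible hres
  -- The resolvent cubic has the roots `x 0 * x 1 + x 2 * x 3`, `x 0 * x 2 + x 1 * x 3` and `x 0 * x
  -- 3 + x 1 * x 2`; it is irreducible since a rational root of a monic integral cubic is an
  -- integer.
  have h3 := natDegree_dvd_card_algEquiv hirr.separable hirr3 L (y := x 0 * x 1 + x 2 * x 3) (by
    simp only [Polynomial.map_add, Polynomial.map_mul, Polynomial.map_pow, map_X, map_C, map_add,
      map_mul, map_pow, aeval_X, aeval_C]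
    simp only [map_add, map_neg, map_sub, map_mul, map_pow, eq_intCast, map_intCast, map_ofNat]
    rw [ha, hb, hc, hd]
    ring)
  rwa [Monic.natDegree_map (by monicity!),
    show (X ^ 3 + C (-b) * X ^ 2 + C (a * c - 4 * d) * X +
      C (-(a ^ 2 * d - 4 * b * d + c ^ 2)) : ℤ[X]).natDegree = 3 by compute_degree!] at h3

theorem isSquare_quarticDisc_of_sign
    (hirr : Irreducible ((quartic a b c d).map (Int.castRingHom ℚ)))
    {x : Fin 4 → L} {φ : (L ≃ₐ[ℚ] L) →* Equiv.Perm (Fin 4)} (hx : Function.Injective x)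
    (h : ∀ i, x i ^ 4 + a * x i ^ 3 + b * x i ^ 2 + c * x i + d = 0)
    (hact : ∀ (σ : L ≃ₐ[ℚ] L) i, σ (x i) = x (φ σ i))
    (hs : ∀ σ, Equiv.Perm.sign (φ σ) = 1) : IsSquare (quarticDisc a b c d) := by
  refine isSquare_of_fixed hirr.separable (y := (Matrix.vandermonde x).det) ?_ fun σ => ?_
  · rw [vandermonde_det_sq hx h]
    simp [quarticDisc]
  · rw [map_vandermonde_det σ x (φ σ) (hact σ), hs]
    simp

end

theorem sign_eq_one_of_isSquare_quarticDisc
    {a b c d : ℤ} {L : Type*} [Field L] [Algebra ℚ L] {x : Fin 4 → L} {φ : (L ≃ₐ[ℚ] L) →* Equiv.Perm (Fin 4)} (hx : Function.Injective x)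
    (h : ∀ i, x i ^ 4 + a * x i ^ 3 + b * x i ^ 2 + c * x i + d = 0)
    (hact : ∀ (σ : L ≃ₐ[ℚ] L) i, σ (x i) = x (φ σ i))
    (hsq : IsSquare (quarticDisc a b c d)) (σ : L ≃ₐ[ℚ] L) : Equiv.Perm.sign (φ σ) = 1 := by
  have := algebraRat.charZero L
  obtain ⟨s, hs⟩ := hsq
  have hδ := Matrix.det_vandermonde_ne_zero_iff.2 hx
  have hδ2 : (Matrix.vandermonde x).det ^ 2 = (s : L) ^ 2 := by
    rw [vandermonde_det_sq hx h, ← Int.cast_pow, sq s, ← hs]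
    simp [quarticDisc]
  have hfix : σ (Matrix.vandermonde x).det = (Matrix.vandermonde x).det := by
    rcases sq_eq_sq_iff_eq_or_eq_neg.1 hδ2 with h | h <;> simp [h]
  rw [map_vandermonde_det σ x (φ σ) (hact σ)] at hfix
  rcases Int.units_eq_one_or (Equiv.Perm.sign (φ σ)) with h1 | h1
  · exact h1
  · rw [h1] at hfix
    simp only [Units.val_neg, Units.val_one, Int.cast_neg, Int.cast_one, neg_mul, one_mul] at hfix
    exact absurd (self_eq_neg.1 hfix.symm) hδ

/-! ### Recognizing the Galois group inside `S₄`. -/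

theorem card_range_of_injective {G H : Type*} [Group G] [Group H] {φ : G →* H}
    (hφ : Function.Injective φ) : Nat.card φ.range = Nat.card G :=
  (Nat.card_congr (MonoidHom.ofInjective hφ).toEquiv).symm

theorem card_range_mul_index (H : Subgroup (Equiv.Perm (Fin 4))) :
    Nat.card H * H.index = 24 := by
  rw [H.card_mul_index, Nat.card_perm, Nat.card_fin]
  rfl

/-- The order is a multiple of `12`, so the index in `S₄` is `1` or `2`. Index `2` means `A₄`, which
would fix the square root of the discriminant. -/
theorem gal_mulEquiv_perm {a b c d : ℤ}
    (hirr : Irreducible ((quartic a b c d).map (Int.castRingHom ℚ)))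
    (hres : ∀ y : ℤ, y ^ 3 + -b * y ^ 2 + (a * c - 4 * d) * y + -(a ^ 2 * d - 4 * b * d + c ^ 2) ≠ 0)
    (hdisc : ¬ IsSquare (quarticDisc a b c d)) :
    Nonempty (GaloisGroupOverQ (quartic a b c d) ≃* Group4T5) := by
  refine nonempty_gal_mulEquiv fun L _ _ _ => ?_
  obtain ⟨x, φ, hx, hφ, h, hact⟩ := quartic_roots_and_action hirr L
  have h4 := four_dvd_card hirr (h 0)
  have h3 := three_dvd_card hirr hres hx h
  have hc := card_range_of_injective hφ
  have hi := card_range_mul_index φ.range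
  rw [← hc] at h3 h4
  have h12 : 12 ∣ Nat.card φ.range := Nat.Coprime.mul_dvd_of_dvd_of_dvd (by norm_num) h3 h4
  have hidx : φ.range.index = 1 := by
    obtain ⟨k, hk⟩ := h12
    rw [hk] at hi
    have : φ.range.index ∣ 2 := ⟨k, by lia⟩
    rcases (Nat.dvd_prime Nat.prime_two).1 this with h1 | h2
    · exact h1
    · refine absurd (isSquare_quarticDisc_of_sign hirr hx h hact fun σ => ?_) hdisc
      have hA := Equiv.Perm.eq_alternatingGroup_of_index_eq_two h2
      have : φ σ ∈ φ.range := ⟨σ, rfl⟩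
      rw [hA] at this
      exact Equiv.Perm.mem_alternatingGroup.1 this
  exact ⟨MulEquiv.ofBijective φ ⟨hφ, MonoidHom.range_eq_top.1 (Subgroup.index_eq_one.1 hidx)⟩⟩

theorem gal_mulEquiv_alternating {a b c d : ℤ}
    (hirr : Irreducible ((quartic a b c d).map (Int.castRingHom ℚ)))
    (hres : ∀ y : ℤ, y ^ 3 + -b * y ^ 2 + (a * c - 4 * d) * y + -(a ^ 2 * d - 4 * b * d + c ^ 2) ≠ 0)
    (hdisc : IsSquare (quarticDisc a b c d)) :
    Nonempty (GaloisGroupOverQ (quartic a b c d) ≃* Group4T4) := by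
  refine nonempty_gal_mulEquiv fun L _ _ _ => ?_
  obtain ⟨x, φ, hx, hφ, h, hact⟩ := quartic_roots_and_action hirr L
  have h4 := four_dvd_card hirr (h 0)
  have h3 := three_dvd_card hirr hres hx h
  have hc := card_range_of_injective hφ
  rw [← hc] at h3 h4
  have h12 : 12 ∣ Nat.card φ.range := Nat.Coprime.mul_dvd_of_dvd_of_dvd (by norm_num) h3 h4
  have hA : φ.range = alternatingGroup (Fin 4) := by
    refine Subgroup.eq_of_le_of_card_ge ?_ ?_
    · rintro _ ⟨σ, rfl⟩
      exact Equiv.Perm.mem_alternatingGroup.2 (sign_eq_one_of_isSquare_quarticDisc hx h hact hdisc σ)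
    · have : Nat.card (alternatingGroup (Fin 4)) = 12 := by
        rw [nat_card_alternatingGroup, Nat.card_fin]
        rfl
      rw [this]
      exact Nat.le_of_dvd Nat.card_pos h12
  exact ⟨(MonoidHom.ofInjective hφ).trans (MulEquiv.subgroupCongr hA)⟩

theorem isKleinFour_of_forall_sq_eq_one {G : Type*} [Group G] (hc : Nat.card G = 4)
    (h : ∀ g : G, g ^ 2 = 1) : IsKleinFour G := by
  refine ⟨hc, ?_⟩
  have : Finite G := Nat.finite_of_card_ne_zero (by lia)
  have : Nontrivial G := Finite.one_lt_card_iff_nontrivial.1 (by lia)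
  exact (Monoid.exponent_eq_prime_iff Nat.prime_two).2 fun g hg => orderOf_eq_prime (h g) hg

/-- The polynomial is even and reciprocal, so its roots are `±θ, ±θ⁻¹`. Hence an automorphism is
determined by its value at one root, and each one is an involution or trivial. -/
theorem gal_mulEquiv_klein {b : ℤ}
    (hirr : Irreducible ((quartic 0 b 0 1).map (Int.castRingHom ℚ))) :
    Nonempty (GaloisGroupOverQ (quartic 0 b 0 1) ≃* Group4T2) := by
  refine nonempty_gal_mulEquiv fun L _ _ _ => ?_
  obtain ⟨x, φ, hx, hφ, h, hact⟩ := quartic_roots_and_action hirr L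
  simp only [Int.cast_zero, zero_mul, add_zero, Int.cast_one] at h
  have h4 := four_dvd_card hirr (x := x 0) (by simpa using h 0)
  have hx0 : ∀ i, x i ≠ 0 := fun i hi => by simpa [hi] using h i
  have hcases : ∀ i j, x j = x i ∨ x j = -x i ∨ x j = (x i)⁻¹ ∨ x j = -(x i)⁻¹ := by
    intro i j
    have h1 : (x j - x i) * ((x j + x i) * ((x j - (x i)⁻¹) * (x j + (x i)⁻¹))) = 0 := by
      have := hx0 i
      field_simp
      linear_combination x i ^ 2 * h j - x j ^ 2 * h i
    rcases mul_eq_zero.1 h1 with h1 | h1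
    · exact .inl (sub_eq_zero.1 h1)
    rcases mul_eq_zero.1 h1 with h1 | h1
    · exact .inr (.inl (eq_neg_of_add_eq_zero_left h1))
    rcases mul_eq_zero.1 h1 with h1 | h1
    · exact .inr (.inr (.inl (sub_eq_zero.1 h1)))
    · exact .inr (.inr (.inr (eq_neg_of_add_eq_zero_left h1)))
  have hsq : ∀ σ : L ≃ₐ[ℚ] L, σ ^ 2 = 1 := by
    intro σ
    apply hφ
    rw [map_one]
    ext1 i
    apply hx
    rw [← hact, sq, AlgEquiv.mul_apply, Equiv.Perm.one_apply, hact]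
    rcases hcases i (φ σ i) with h1 | h1 | h1 | h1 <;>
    · have h2 := hact σ i
      rw [h1] at h2 ⊢
      simp [h2]
  have hinj : Function.Injective fun σ : L ≃ₐ[ℚ] L => φ σ 0 := by
    intro σ τ hστ
    have h0 : σ (x 0) = τ (x 0) := by rw [hact, hact]; exact congrArg x hστ
    apply hφ
    ext1 i
    apply hx
    rw [← hact, ← hact]
    rcases hcases 0 i with h1 | h1 | h1 | h1 <;> simp [h1, h0]
  have hcard : Nat.card (L ≃ₐ[ℚ] L) = 4 := by
    have hle := Nat.card_le_card_of_injective _ hinj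
    rw [Nat.card_fin] at hle
    have : Finite (L ≃ₐ[ℚ] L) := Finite.of_injective _ hinj
    exact le_antisymm hle (Nat.le_of_dvd Nat.card_pos h4)
  have := isKleinFour_of_forall_sq_eq_one hcard hsq
  have : IsKleinFour Group4T2 :=
    isKleinFour_of_forall_sq_eq_one (by simp) (by decide)
  exact IsKleinFour.nonempty_mulEquiv

/-- The standard embedding of the dihedral group of order `8` in `S₄`. -/
def dihedralToPerm : DihedralGroup 4 →* Equiv.Perm (Fin 4) where
  toFun
    | .r i => finRotate 4 ^ i.val
    | .sr i => Fin.revPerm * finRotate 4 ^ i.val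
  map_one' := by decide
  map_mul' := by decide

theorem dihedralToPerm_injective : Function.Injective dihedralToPerm := by decide

/-- Subgroups of order `8` of `S₄` are Sylow `2`-subgroups, hence all isomorphic. -/
theorem nonempty_mulEquiv_dihedral {G : Type*} [Group G] {φ : G →* Equiv.Perm (Fin 4)}
    (hφ : Function.Injective φ) (hc : Nat.card G = 8) : Nonempty (G ≃* DihedralGroup 4) := by
  have hfac : (Nat.card (Equiv.Perm (Fin 4))).factorization 2 = 3 := by
    rw [Nat.card_perm, Nat.card_fin, show Nat.factorial 4 = 2 ^ 3 * 3 by rfl,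
      Nat.factorization_mul (by norm_num) (by norm_num), Nat.factorization_pow]
    simp [Nat.Prime.factorization Nat.prime_two, Nat.Prime.factorization Nat.prime_three]
  let P : Sylow 2 (Equiv.Perm (Fin 4)) := Sylow.ofCard φ.range (by
    rw [card_range_of_injective hφ, hc, hfac]; rfl)
  let Q : Sylow 2 (Equiv.Perm (Fin 4)) := Sylow.ofCard dihedralToPerm.range (by
    rw [card_range_of_injective dihedralToPerm_injective, hfac, DihedralGroup.nat_card]; rfl)
  exact ⟨(MonoidHom.ofInjective hφ).trans ((P.equiv Q).trans
    (MonoidHom.ofInjective dihedralToPerm_injective).symm)⟩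

/-- The permutation preserves the partition of `{0, 1, 2, 3}` in `{0, 1}` and `{2, 3}`. -/
abbrev PreservesPairs (π : Equiv.Perm (Fin 4)) : Prop := (π 0).val / 2 = (π 1).val / 2

/-- The permutation maps `0` to the second pair. -/
abbrev SwapsPairs (π : Equiv.Perm (Fin 4)) : Prop := (π 0).val / 2 = 1

theorem eq_one_of_preservesPairs_of_pow_three (π : Equiv.Perm (Fin 4)) :
    PreservesPairs π → π ^ 3 = 1 → π = 1 := by
  revert π; decide

/-- On the stabilizer of the partition, a copy of `D₄`, swapping the pairs and the sign are two
characters whose common kernel is the centre. Commuting noncentral elements of `D₄` agree modulo the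
centre. -/
theorem swapsPairs_iff_and_sign_iff_of_commute : ∀ σ τ : Equiv.Perm (Fin 4),
    PreservesPairs σ → PreservesPairs τ →
    (SwapsPairs σ ∨ Equiv.Perm.sign σ ≠ 1) → (SwapsPairs τ ∨ Equiv.Perm.sign τ ≠ 1) →
    σ * τ = τ * σ →
    (SwapsPairs σ ↔ SwapsPairs τ) ∧ (Equiv.Perm.sign σ = 1 ↔ Equiv.Perm.sign τ = 1) := by
  decide

/-- The last three hypotheses say that the swap character, the sign and their product are all
nontrivial. A group of order `4` would be abelian, and then all its noncentral elements would have
the same pair of character values, which these hypotheses exclude. Preserving the pairs excludes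
elements of order `3`. -/
theorem card_eq_eight {G : Type*} [Group G] {φ : G →* Equiv.Perm (Fin 4)}
    (hφ : Function.Injective φ) (h4 : 4 ∣ Nat.card G) (hpres : ∀ σ, PreservesPairs (φ σ))
    (h1 : ∃ σ, SwapsPairs (φ σ)) (h2 : ∃ σ, Equiv.Perm.sign (φ σ) ≠ 1)
    (h3 : ∃ σ, ¬ (SwapsPairs (φ σ) ↔ Equiv.Perm.sign (φ σ) ≠ 1)) : Nat.card G = 8 := by
  have : Finite G := Finite.of_injective φ hφ
  have hi := card_range_mul_index φ.range
  rw [card_range_of_injective hφ] at hi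
  have hn3 : ¬ 3 ∣ Nat.card G := by
    intro h
    obtain ⟨σ, hσ⟩ := exists_prime_orderOf_dvd_card' 3 h
    have h1 : σ ^ 3 = 1 := hσ ▸ pow_orderOf_eq_one σ
    have h2 := eq_one_of_preservesPairs_of_pow_three (φ σ) (hpres σ)
      (by rw [← map_pow, h1, map_one])
    rw [hφ (h2.trans (map_one φ).symm), orderOf_one] at hσ
    lia
  have hn4 : Nat.card G ≠ 4 := by
    intro hc
    have : Fact (Nat.Prime 2) := ⟨Nat.prime_two⟩
    have hcomm := (IsPGroup.isMulCommutative_of_card_eq_prime_sq (p := 2) hc).is_comm.comm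
    have hcomm' : ∀ σ τ, φ σ * φ τ = φ τ * φ σ := fun σ τ => by
      rw [← map_mul, ← map_mul, hcomm]
    obtain ⟨σ, hσ⟩ := h1
    obtain ⟨τ, hτ⟩ := h2
    obtain ⟨ρ, hρ⟩ := h3
    have e1 := swapsPairs_iff_and_sign_iff_of_commute _ _ (hpres σ) (hpres τ) (.inl hσ) (.inr hτ)
      (hcomm' σ τ)
    have e2 := swapsPairs_iff_and_sign_iff_of_commute _ _ (hpres σ) (hpres ρ) (.inl hσ)
      (by tauto) (hcomm' σ ρ)
    tauto
  obtain ⟨k, hk⟩ := h4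
  have hk6 : k ∣ 6 := ⟨φ.range.index, by rw [hk] at hi; lia⟩
  have hk6' := Nat.le_of_dvd (by norm_num) hk6
  rw [hk] at hn3 hn4 ⊢
  interval_cases k <;> first | rfl | (exfalso; revert hn3 hn4 hk6; norm_num)

theorem exists_relabeling {a b c d β : ℤ}
    (hirr : Irreducible ((quartic a b c d).map (Int.castRingHom ℚ)))
    (hβ : β ^ 3 + -b * β ^ 2 + (a * c - 4 * d) * β + -(a ^ 2 * d - 4 * b * d + c ^ 2) = 0)
    (L : Type*) [Field L] [Algebra ℚ L]
    [IsSplittingField ℚ L ((quartic a b c d).map (Int.castRingHom ℚ))] :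
    ∃ (x : Fin 4 → L) (φ : (L ≃ₐ[ℚ] L) →* Equiv.Perm (Fin 4)),
      Function.Injective x ∧ Function.Injective φ ∧
      (∀ i, x i ^ 4 + a * x i ^ 3 + b * x i ^ 2 + c * x i + d = 0) ∧
      (∀ (σ : L ≃ₐ[ℚ] L) i, σ (x i) = x (φ σ i)) ∧ x 0 * x 1 + x 2 * x 3 = β := by
  obtain ⟨x, φ, hx, hφ, h, hact⟩ := quartic_roots_and_action hirr L
  suffices ∃ π : Equiv.Perm (Fin 4), x (π 0) * x (π 1) + x (π 2) * x (π 3) = β by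
    obtain ⟨π, hπ⟩ := this
    -- Renumbering the roots by `π` conjugates the action.
    refine ⟨x ∘ π, (MulAut.conj π⁻¹).toMonoidHom.comp φ, hx.comp π.injective,
      (MulAut.conj π⁻¹).injective.comp hφ, fun i => h (π i), fun σ i => ?_, hπ⟩
    simp [hact]
  obtain ⟨ha, hb, hc, hd⟩ := quartic_vieta hx h
  have hβL : (β : L) ^ 3 + -b * β ^ 2 + (a * c - 4 * d) * β +
      -(a ^ 2 * d - 4 * b * d + c ^ 2) = 0 := by exact_mod_cast congrArg (Int.cast : ℤ → L) hβ
  rw [ha, hb, hc, hd] at hβL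
  have hprod : (x 0 * x 1 + x 2 * x 3 - β) * ((x 0 * x 2 + x 1 * x 3 - β) *
      (x 0 * x 3 + x 2 * x 1 - β)) = 0 := by linear_combination -hβL
  rcases mul_eq_zero.1 hprod with h1 | h1
  · exact ⟨1, sub_eq_zero.1 h1⟩
  rcases mul_eq_zero.1 h1 with h1 | h1
  · refine ⟨Equiv.swap 1 2, ?_⟩
    simpa [Equiv.swap_apply_def] using sub_eq_zero.1 h1
  · refine ⟨Equiv.swap 1 3, ?_⟩
    simpa [Equiv.swap_apply_def] using sub_eq_zero.1 h1

theorem perm_fin_four_cases : ∀ π : Equiv.Perm (Fin 4),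
    (PreservesPairs π ∧ ¬ SwapsPairs π ∧
      (π 0 = 0 ∧ π 1 = 1 ∨ π 0 = 1 ∧ π 1 = 0) ∧ (π 2 = 2 ∧ π 3 = 3 ∨ π 2 = 3 ∧ π 3 = 2)) ∨
    (PreservesPairs π ∧ SwapsPairs π ∧
      (π 0 = 2 ∧ π 1 = 3 ∨ π 0 = 3 ∧ π 1 = 2) ∧ (π 2 = 0 ∧ π 3 = 1 ∨ π 2 = 1 ∧ π 3 = 0)) ∨
    (π 0 = 0 ∧ π 1 = 2 ∨ π 0 = 2 ∧ π 1 = 0) ∧ (π 2 = 1 ∧ π 3 = 3 ∨ π 2 = 3 ∧ π 3 = 1) ∨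
    (π 0 = 1 ∧ π 1 = 3 ∨ π 0 = 3 ∧ π 1 = 1) ∧ (π 2 = 0 ∧ π 3 = 2 ∨ π 2 = 2 ∧ π 3 = 0) ∨
    (π 0 = 0 ∧ π 1 = 3 ∨ π 0 = 3 ∧ π 1 = 0) ∧ (π 2 = 1 ∧ π 3 = 2 ∨ π 2 = 2 ∧ π 3 = 1) ∨
    (π 0 = 1 ∧ π 1 = 2 ∨ π 0 = 2 ∧ π 1 = 1) ∧ (π 2 = 0 ∧ π 3 = 3 ∨ π 2 = 3 ∧ π 3 = 0) := by
  decide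

/-- The differences of the resolvent root `x 0 * x 1 + x 2 * x 3` with the other two are `(x 0 - x
3)(x 1 - x 2)` and `(x 0 - x 2)(x 1 - x 3)`, both nonzero. So a permutation fixing its value must
preserve the pairs, and it acts on `x 0 * x 1 - x 2 * x 3` by the swap character. -/
theorem swapsPairs_or_of_fixed {L : Type*} [Field L] {x : Fin 4 → L} (hx : Function.Injective x)
    {π : Equiv.Perm (Fin 4)}
    (h : x (π 0) * x (π 1) + x (π 2) * x (π 3) = x 0 * x 1 + x 2 * x 3) :
    PreservesPairs π ∧ ((¬ SwapsPairs π ∧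
      x (π 0) * x (π 1) - x (π 2) * x (π 3) = x 0 * x 1 - x 2 * x 3) ∨
      (SwapsPairs π ∧ x (π 0) * x (π 1) - x (π 2) * x (π 3) = -(x 0 * x 1 - x 2 * x 3))) := by
  have n12 : (x 0 - x 3) * (x 1 - x 2) ≠ 0 :=
    mul_ne_zero (sub_ne_zero.2 (hx.ne (by decide))) (sub_ne_zero.2 (hx.ne (by decide)))
  have n13 : (x 0 - x 2) * (x 1 - x 3) ≠ 0 :=
    mul_ne_zero (sub_ne_zero.2 (hx.ne (by decide))) (sub_ne_zero.2 (hx.ne (by decide)))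
  rcases perm_fin_four_cases π with ⟨hp, hs, h1, h2⟩ | ⟨hp, hs, h1, h2⟩ | ⟨h1, h2⟩ | ⟨h1, h2⟩ |
    ⟨h1, h2⟩ | ⟨h1, h2⟩
  · refine ⟨hp, .inl ⟨hs, ?_⟩⟩
    rcases h1 with ⟨e0, e1⟩ | ⟨e0, e1⟩ <;> rcases h2 with ⟨e2, e3⟩ | ⟨e2, e3⟩ <;>
    rw [e0, e1, e2, e3] <;> ring
  · refine ⟨hp, .inr ⟨hs, ?_⟩⟩
    rcases h1 with ⟨e0, e1⟩ | ⟨e0, e1⟩ <;> rcases h2 with ⟨e2, e3⟩ | ⟨e2, e3⟩ <;>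
    · rw [e0, e1, e2, e3]
      ring
  · refine absurd ?_ n12
    rcases h1 with ⟨e0, e1⟩ | ⟨e0, e1⟩ <;> rcases h2 with ⟨e2, e3⟩ | ⟨e2, e3⟩ <;>
    · rw [e0, e1, e2, e3] at h
      linear_combination -h
  · refine absurd ?_ n12
    rcases h1 with ⟨e0, e1⟩ | ⟨e0, e1⟩ <;> rcases h2 with ⟨e2, e3⟩ | ⟨e2, e3⟩ <;>
    · rw [e0, e1, e2, e3] at h
      linear_combination -h
  · refine absurd ?_ n13
    rcases h1 with ⟨e0, e1⟩ | ⟨e0, e1⟩ <;> rcases h2 with ⟨e2, e3⟩ | ⟨e2, e3⟩ <;>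
    · rw [e0, e1, e2, e3] at h
      linear_combination -h
  · refine absurd ?_ n13
    rcases h1 with ⟨e0, e1⟩ | ⟨e0, e1⟩ <;> rcases h2 with ⟨e2, e3⟩ | ⟨e2, e3⟩ <;>
    · rw [e0, e1, e2, e3] at h
      linear_combination -h

/-- With `β = x 0 * x 1 + x 2 * x 3`, the element `ε = x 0 * x 1 - x 2 * x 3` has square `β² - 4d`.
The group acts on `ε`, on the Vandermonde determinant `δ` and on `εδ` through the swap character,
the sign and their product; each character is nontrivial because the corresponding square is not a
square in `ℤ`. -/
theorem gal_mulEquiv_dihedral {a b c d β : ℤ}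
    (hirr : Irreducible ((quartic a b c d).map (Int.castRingHom ℚ)))
    (hβ : β ^ 3 + -b * β ^ 2 + (a * c - 4 * d) * β + -(a ^ 2 * d - 4 * b * d + c ^ 2) = 0)
    (h1 : ¬ IsSquare (β ^ 2 - 4 * d)) (h2 : ¬ IsSquare (quarticDisc a b c d))
    (h3 : ¬ IsSquare ((β ^ 2 - 4 * d) * quarticDisc a b c d)) :
    Nonempty (GaloisGroupOverQ (quartic a b c d) ≃* Group4T3) := by
  refine nonempty_gal_mulEquiv fun L _ _ _ => ?_
  obtain ⟨x, φ, hx, hφ, h, hact, hxβ⟩ := exists_relabeling hirr hβ L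
  obtain ⟨-, -, -, hd⟩ := quartic_vieta hx h
  have hfix : ∀ σ, x (φ σ 0) * x (φ σ 1) + x (φ σ 2) * x (φ σ 3) = x 0 * x 1 + x 2 * x 3 := by
    intro σ
    rw [← hact, ← hact, ← hact, ← hact, ← map_mul, ← map_mul, ← map_add, hxβ, map_intCast]
  have hpair := fun σ => swapsPairs_or_of_fixed hx (hfix σ)
  have hε2 : (x 0 * x 1 - x 2 * x 3) ^ 2 = ((β ^ 2 - 4 * d : ℤ) : L) := by
    push_cast
    rw [← hxβ, hd]
    ring
  have hε : ∀ σ : L ≃ₐ[ℚ] L, (¬ SwapsPairs (φ σ) ∧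
      σ (x 0 * x 1 - x 2 * x 3) = x 0 * x 1 - x 2 * x 3) ∨
      (SwapsPairs (φ σ) ∧ σ (x 0 * x 1 - x 2 * x 3) = -(x 0 * x 1 - x 2 * x 3)) := by
    intro σ
    rw [map_sub, map_mul, map_mul, hact, hact, hact, hact]
    exact (hpair σ).2
  refine nonempty_mulEquiv_dihedral hφ (card_eq_eight hφ (four_dvd_card hirr (h 0))
    (fun σ => (hpair σ).1) ?_ ?_ ?_)
  · by_contra! hn
    exact h1 (isSquare_of_fixed hirr.separable hε2 fun σ => by
      rcases hε σ with hσ | hσ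
      · exact hσ.2
      · exact absurd hσ.1 (hn σ))
  · by_contra! hn
    exact h2 (isSquare_quarticDisc_of_sign hirr hx h hact hn)
  · by_contra! hn
    refine h3 (isSquare_of_fixed hirr.separable
      (y := (x 0 * x 1 - x 2 * x 3) * (Matrix.vandermonde x).det) ?_ fun σ => ?_)
    · rw [mul_pow, hε2, vandermonde_det_sq hx h]
      simp [quarticDisc]
    · rw [map_mul, map_vandermonde_det σ x (φ σ) (hact σ)]
      rcases hε σ with ⟨hs, he⟩ | ⟨hs, he⟩
      · have : Equiv.Perm.sign (φ σ) = 1 := by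
          by_contra hne
          exact hs ((hn σ).2 hne)
        rw [he, this]
        simp
      · have : Equiv.Perm.sign (φ σ) = -1 :=
          (Int.units_eq_one_or _).resolve_left ((hn σ).1 hs)
        rw [he, this]
        simp
        ring

/-! ### A sieve for squarefree values. -/

theorem card_Icc_filter_dvd_le {M : ℕ} {a b : ℤ} (ha : IsCoprime a (M : ℤ)) (N : ℕ) :
    ((Finset.Icc 1 N).filter fun t : ℕ => (M : ℤ) ∣ a * t + b).card ≤ N / M + 1 := by
  classical
  have key : ∀ t s : ℕ, (M : ℤ) ∣ a * t + b → (M : ℤ) ∣ a * s + b → t ≡ s [MOD M] := by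
    intro t s ht hs
    rw [← Int.natCast_modEq_iff, Int.modEq_comm, Int.modEq_iff_dvd]
    exact ha.symm.dvd_of_dvd_mul_left (by
      have := dvd_sub ht hs
      rwa [show a * t + b - (a * s + b) = a * ((t : ℤ) - s) by ring] at this)
  have hmaps : ∀ t ∈ (Finset.Icc 1 N).filter fun t : ℕ => (M : ℤ) ∣ a * t + b,
      t / M ∈ Finset.range (N / M + 1) := by
    intro t ht
    simp only [Finset.mem_filter, Finset.mem_Icc] at ht
    exact Finset.mem_range.2 (Nat.lt_succ_of_le (Nat.div_le_div_right ht.1.2))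
  have := Finset.card_le_card_of_injOn (fun t => t / M) hmaps (by
    intro t ht s hs hts
    simp only [Finset.coe_filter, Finset.mem_Icc, Set.mem_ofPred_eq] at ht hs
    have h1 := key t s ht.2 hs.2
    have h2 := Nat.div_add_mod t M
    have h3 := Nat.div_add_mod s M
    simp only at hts
    rw [← h2, ← h3, hts, h1])
  simpa using this

/-- Since `(2n + 3)² > 4(n + 1)(n + 2)`, the sum is dominated by a telescoping one. -/
theorem sum_inv_sq_odd_le (Y : ℕ) :
    ∑ k ∈ Finset.range Y, (1 : ℝ) / (2 * (k + 1 : ℕ) + 1 : ℕ) ^ 2 ≤ 1 / 4 := by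
  have h : ∀ Y : ℕ, ∑ k ∈ Finset.range Y, (1 : ℝ) / (2 * (k + 1 : ℕ) + 1 : ℕ) ^ 2
      ≤ 1 / 4 - 1 / (4 * (Y + 1)) := by
    intro Y
    induction Y with
    | zero => simp
    | succ n ih =>
      rw [Finset.sum_range_succ]
      have : (1 : ℝ) / (2 * (n + 1 : ℕ) + 1 : ℕ) ^ 2 ≤ 1 / (4 * (n + 1)) - 1 / (4 * ((n + 1 : ℕ) + 1)) := by
        push_cast
        rw [div_sub_div _ _ (by positivity) (by positivity), div_le_div_iff₀ (by positivity) (by positivity)]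
        nlinarith
      linarith
  exact (h Y).trans (by have : (0 : ℝ) ≤ 1 / (4 * (Y + 1)) := by positivity
                        linarith)

theorem sum_inv_sq_primes_le (s : Finset ℕ) (hs : ∀ p ∈ s, p.Prime ∧ p ≠ 2) :
    ∑ p ∈ s, (1 : ℝ) / p ^ 2 ≤ 1 / 4 := by
  classical
  -- The truncated subtraction is harmless, because an odd prime is at least `3`.
  have hodd : ∀ p ∈ s, p = 2 * ((p - 3) / 2 + 1) + 1 := by
    intro p hp
    obtain ⟨h1, h2⟩ := hs p hp
    have := h1.two_le
    have := h1.eq_two_or_odd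
    lia
  refine le_trans ?_ (sum_inv_sq_odd_le (s.sup id))
  have : ∑ p ∈ s, (1 : ℝ) / p ^ 2 = ∑ k ∈ s.image (fun p => (p - 3) / 2),
      (1 : ℝ) / (2 * (k + 1 : ℕ) + 1 : ℕ) ^ 2 := by
    rw [Finset.sum_image]
    · exact Finset.sum_congr rfl fun p hp => by rw [← hodd p hp]
    · intro p hp q hq h
      have h1 := hodd p hp
      have h2 := hodd q hq
      simp only at h
      rw [h1, h2, h]
  rw [this]
  refine Finset.sum_le_sum_of_subset_of_nonneg ?_ fun _ _ _ => by positivity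
  intro k hk
  obtain ⟨p, hp, rfl⟩ := Finset.mem_image.1 hk
  have h1 : p ≤ s.sup id := Finset.le_sup (f := id) hp
  have := hodd p hp
  rw [Finset.mem_range]
  lia

open Filter in
/-- A sieve for squarefree values: if for every odd prime `p` at most `3 (N / p ^ 2 + 1)` of the
integers `1, …, N` are bad at `p`, and none is bad at a prime `p > c N`, then infinitely many
integers are not bad at any odd prime. -/
theorem infinite_not_bad (bad : ℕ → ℕ → Prop) {c : ℕ} (hc : 0 < c)
    (hcard : ∀ p : ℕ, p.Prime → p ≠ 2 → ∀ N : ℕ, ∃ s : Finset ℕ,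
      (∀ t ∈ Finset.Icc 1 N, bad p t → t ∈ s) ∧ s.card ≤ 3 * (N / p ^ 2 + 1))
    (hle : ∀ p t N : ℕ, p.Prime → 1 ≤ t → t ≤ N → bad p t → p ≤ c * N) :
    {t : ℕ | ∀ p : ℕ, p.Prime → p ≠ 2 → ¬ bad p t}.Infinite := by
  classical
  by_contra hfin
  rw [Set.not_infinite] at hfin
  -- Union bound: each of `1, …, N` lies in the supposedly finite set or is bad at an odd prime `p ≤
  -- cN`. The terms `3N/p²` add up to at most `3N/4`, the terms `3` to at most `3π(cN)`.
  have hbound : ∀ N : ℕ, (N : ℝ) ≤ hfin.toFinset.card + (3 / 4 * N + 3 * (Nat.primeCounting (c * N) : ℝ)) := by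
    intro N
    let P := ((Finset.range (c * N + 1)).filter Nat.Prime).erase 2
    choose! s hs hsc using fun p (hp : p.Prime ∧ p ≠ 2) => hcard p hp.1 hp.2 N
    have hsub : Finset.Icc 1 N ⊆ hfin.toFinset ∪ P.biUnion s := by
      intro t ht
      by_cases hb : ∀ p : ℕ, p.Prime → p ≠ 2 → ¬ bad p t
      · exact Finset.mem_union_left _ (hfin.mem_toFinset.2 hb)
      · push Not at hb
        obtain ⟨p, hp, hp2, hb⟩ := hb
        refine Finset.mem_union_right _ (Finset.mem_biUnion.2 ⟨p, ?_, hs p ⟨hp, hp2⟩ t ht hb⟩)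
        obtain ⟨h1, h2⟩ := Finset.mem_Icc.1 ht
        simp only [P, Finset.mem_erase, Finset.mem_filter, Finset.mem_range]
        exact ⟨hp2, Nat.lt_succ_of_le (hle p t N hp h1 h2 hb), hp⟩
    have hP : ∀ p ∈ P, p.Prime ∧ p ≠ 2 := by
      intro p hp
      simp only [P, Finset.mem_erase, Finset.mem_filter] at hp
      exact ⟨hp.2.2, hp.1⟩
    have h1 : (N : ℝ) ≤ hfin.toFinset.card + ∑ p ∈ P, ((s p).card : ℝ) := by
      have h2 := (Finset.card_le_card hsub).trans ((Finset.card_union_le _ _).trans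
        (Nat.add_le_add_left Finset.card_biUnion_le _))
      rw [Nat.card_Icc, Nat.add_sub_cancel] at h2
      exact_mod_cast h2
    have h2 : ∑ p ∈ P, ((s p).card : ℝ) ≤ ∑ p ∈ P, (3 * N * (1 / (p : ℝ) ^ 2) + 3) := by
      refine Finset.sum_le_sum fun p hp => ?_
      have h3 : ((s p).card : ℝ) ≤ 3 * ((N / p ^ 2 : ℕ) + 1) := by
        exact_mod_cast hsc p (hP p hp)
      have h4 : ((N / p ^ 2 : ℕ) : ℝ) ≤ N / p ^ 2 := by
        exact_mod_cast Nat.cast_div_le (α := ℝ) (m := N) (n := p ^ 2)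
      calc ((s p).card : ℝ) ≤ 3 * (N / p ^ 2 + 1) := by linarith
        _ = _ := by ring
    have hPc : (P.card : ℝ) ≤ Nat.primeCounting (c * N) := by
      have : P.card ≤ Nat.primeCounting (c * N) := by
        rw [Nat.primeCounting, Nat.primeCounting', Nat.count_eq_card_filter_range]
        exact Finset.card_le_card (Finset.erase_subset _ _)
      exact_mod_cast this
    rw [Finset.sum_add_distrib, ← Finset.mul_sum, Finset.sum_const, nsmul_eq_mul] at h2
    have h5 := mul_le_mul_of_nonneg_left (sum_inv_sq_primes_le P hP) (by positivity : (0 : ℝ) ≤ 3 * N)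
    linarith
  -- With `N / 24` the error `3π(cN)` is at most `N / 8`. A proportion `1/8` survives, contradicting
  -- finiteness once `N` exceeds `8` times the size of the finite set.
  have hlim : ∀ᶠ N : ℕ in atTop, (Nat.primeCounting (c * N) : ℝ) ≤ N / 24 := by
    have hcN : Tendsto (fun N : ℕ => ((c * N : ℕ) : ℝ)) atTop atTop :=
      tendsto_natCast_atTop_atTop.comp (tendsto_id.const_mul_atTop' hc)
    have hlog := (Real.tendsto_log_atTop.comp hcN).eventually_ge_atTop
      (24 * c * (Real.log 4 + 1))
    have hpos := (Real.tendsto_log_atTop.comp hcN).eventually_gt_atTop 0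
    filter_upwards [hcN.eventually (Chebyshev.eventually_primeCounting_le one_pos), hlog, hpos]
      with N h1 h2 h3
    rw [Nat.floor_natCast] at h1
    refine h1.trans ?_
    simp only [Function.comp_apply] at h2 h3
    rw [div_le_div_iff₀ h3 (by norm_num)]
    push_cast at h2 ⊢
    nlinarith [mul_le_mul_of_nonneg_left h2 (Nat.cast_nonneg (α := ℝ) N)]
  obtain ⟨N, hN, hN2⟩ := (hlim.and (eventually_gt_atTop (8 * hfin.toFinset.card))).exists
  have := hbound N
  have h3 : (8 * hfin.toFinset.card : ℝ) < N := by exact_mod_cast hN2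
  linarith

/-! ### The field discriminant as an isomorphism invariant. -/

/-- The powers of `θ` are an integral basis, and the matrix of their embeddings in `ℂ` is the
transposed Vandermonde matrix of the roots. -/
theorem discr_eq_quarticDisc {a b c d : ℤ} (hmono : IsMonogenicPoly (quartic a b c d)) {θ : ℂ}
    (hθ : aeval θ (quartic a b c d) = 0) [NumberField ℚ⟮θ⟯] :
    NumberField.discr ℚ⟮θ⟯ = quarticDisc a b c d := by
  obtain ⟨hf, hirr, hbasis⟩ := hmono
  obtain ⟨B₀, hB₀⟩ := hbasis θ hθ
  let B := B₀.reindex (finCongr (quartic_natDegree a b c d))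
  have hB : ∀ i, (B i : ℚ⟮θ⟯) = AdjoinSimple.gen ℚ θ ^ (i : ℕ) := fun i => by
    apply Subtype.ext
    have := hB₀ ((finCongr (quartic_natDegree a b c d)).symm i)
    simpa [B, Module.Basis.reindex_apply] using this
  let BQ := B.localizationLocalization ℚ (nonZeroDivisors ℤ) ℚ⟮θ⟯
  have hBQ : ∀ i, BQ i = AdjoinSimple.gen ℚ θ ^ (i : ℕ) := fun i => by
    rw [← hB, Module.Basis.localizationLocalization_apply]
  have hcard : Fintype.card (Fin 4) = Fintype.card (ℚ⟮θ⟯ →ₐ[ℚ] ℂ) := by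
    rw [AlgHom.card, Module.finrank_eq_card_basis BQ]
  let e : Fin 4 ≃ (ℚ⟮θ⟯ →ₐ[ℚ] ℂ) := Fintype.equivOfCardEq hcard
  let x : Fin 4 → ℂ := fun i => e i (AdjoinSimple.gen ℚ θ)
  have hx : Function.Injective x := fun i j hij => e.injective
    ((adjoin.powerBasis (isIntegral_of_monic_aeval hf hθ)).algHom_ext hij)
  have hroot : ∀ i, x i ^ 4 + a * x i ^ 3 + b * x i ^ 2 + c * x i + d = 0 := by
    intro i
    have h1 := congrArg (e i) (aeval_gen_eq_zero hθ)
    rw [aeval_quartic] at h1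
    simpa using h1
  have h1 := Algebra.discr_eq_det_embeddingsMatrixReindex_pow_two ℚ ℂ BQ e
  have h2 : Algebra.embeddingsMatrixReindex ℚ ℂ BQ e = (Matrix.vandermonde x).transpose := by
    ext i j
    simp [Algebra.embeddingsMatrixReindex, Algebra.embeddingsMatrix, Matrix.vandermonde_apply, hBQ,
      x]
  rw [h2, Matrix.det_transpose, vandermonde_det_sq hx hroot,
    Algebra.discr_localizationLocalization, NumberField.discr_eq_discr] at h1
  have h3 : ((NumberField.discr ℚ⟮θ⟯ : ℤ) : ℂ) = ((quarticDisc a b c d : ℤ) : ℂ) := by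
    simpa [quarticDisc] using h1
  exact_mod_cast h3

theorem quarticDisc_eq_of_ringEquiv {a b c d a' b' c' d' : ℤ}
    (h : IsMonogenicPoly (quartic a b c d)) (h' : IsMonogenicPoly (quartic a' b' c' d'))
    {α β : ℂ} (hα : aeval α (quartic a b c d) = 0) (hβ : aeval β (quartic a' b' c' d') = 0)
    (e : ℚ⟮α⟯ ≃+* ℚ⟮β⟯) : quarticDisc a b c d = quarticDisc a' b' c' d' := by
  have := numberField_adjoin_simple h.1 hα
  have := numberField_adjoin_simple h'.1 hβ
  rw [← discr_eq_quarticDisc h hα, ← discr_eq_quarticDisc h' hβ]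
  exact NumberField.discr_eq_discr_of_ringEquiv _ e

theorem isInfiniteFamily {G : Type} [Group G] {f : ℤ → ℤ[X]} {S : Set ℤ} (hS : S.Infinite)
    (hinj : Function.Injective f) (hdeg : ∀ t, (f t).natDegree = 4)
    (hmono : ∀ t ∈ S, IsMonogenicPoly (f t)) (hgal : ∀ t, Nonempty (GaloisGroupOverQ (f t) ≃* G))
    (hiso : ∀ s ∈ S, ∀ t ∈ S, s ≠ t → GenerateDistinctFields (f s) (f t)) :
    IsInfiniteFamilyOfMonogenicQuartics G f S :=
  ⟨hS.image hinj.injOn, fun t ht => ⟨hdeg t, hmono t ht, hgal t⟩, hiso⟩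

/-! ### Irreducibility, monogenicity and non-square criteria for integral quartics. -/

/-- An Eisenstein polynomial at `2` is irreducible over `ℚ`. -/
theorem quartic_irreducible_of_even {a b c d : ℤ} (ha : 2 ∣ a) (hb : 2 ∣ b) (hc : 2 ∣ c)
    (hd : 2 ∣ d) (hd4 : ¬ 4 ∣ d) : Irreducible ((quartic a b c d).map (Int.castRingHom ℚ)) := by
  have hm := quartic_monic a b c d
  rw [← algebraMap_int_eq, ← Monic.irreducible_iff_irreducible_map_fraction_map hm]
  have hprime : (Ideal.span {(2 : ℤ)}).IsPrime :=
    (Ideal.span_singleton_prime two_ne_zero).2 Int.prime_two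
  refine irreducible_of_eisenstein_criterion hprime ?_ ?_ ?_ ?_ hm.isPrimitive
  · rw [hm.leadingCoeff, Ideal.mem_span_singleton]
    norm_num
  · intro n hn
    rw [degree_eq_natDegree hm.ne_zero, quartic_natDegree] at hn
    have hn' : n < 4 := by exact_mod_cast hn
    rw [Ideal.mem_span_singleton]
    interval_cases n <;>
      simpa [quartic, coeff_X, coeff_C, coeff_X_pow, -eq_intCast]
  · rw [degree_eq_natDegree hm.ne_zero, quartic_natDegree]
    norm_num
  · rw [Ideal.span_singleton_pow, Ideal.mem_span_singleton]
    simpa [quartic] using hd4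

/-- A quartic that is Eisenstein at `2` after the substitution `x ↦ x - 1` is irreducible. -/
theorem quartic_irreducible_of_shift {a b c d : ℤ} (ha : 2 ∣ a) (hb : 2 ∣ b) (hc : 2 ∣ c)
    (hd : 2 ∣ d + 1) (hd4 : ¬ 4 ∣ 1 - a + b - c + d) :
    Irreducible ((quartic a b c d).map (Int.castRingHom ℚ)) := by
  have h := quartic_irreducible_of_even (a := a - 4) (b := b - 3 * a + 6)
    (c := -4 + 3 * a - 2 * b + c) (d := 1 - a + b - c + d) (by lia) (by lia) (by lia) (by lia) hd4
  rw [← MulEquiv.irreducible_iff (algEquivAevalXAddC (1 : ℚ))] at h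
  convert h using 1
  simp [quartic, map_ofNat (aeval (X + 1 : ℚ[X]))]
  ring

@[simp]
theorem eval₂_intCastRingHom_intCast {k : Type*} [Ring k] (x : k) (n : ℤ) :
    eval₂ (Int.castRingHom k) x (n : ℤ[X]) = n := by
  rw [← eq_intCast C, eval₂_C, eq_intCast]

/-- A form of Dedekind's criterion for quartics: if at every double root `x` of the quartic in a
field of positive characteristic the criterion is satisfied, the quartic is monogenic. The last
hypothesis that may be used expresses that the quartic lies in the square of the kernel of the
evaluation at `x`. -/
theorem isMonogenicPoly_quartic_of_forall_field {a b c d : ℤ}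
    (hirr : Irreducible ((quartic a b c d).map (Int.castRingHom ℚ)))
    (H : ∀ (k : Type) [Field k] (x : k), x ^ 4 + a * x ^ 3 + b * x ^ 2 + c * x + d = 0 →
      4 * x ^ 3 + 3 * a * x ^ 2 + 2 * b * x + c = 0 →
      (∀ (n : ℤ) (s g A B u : ℤ[X]), Squarefree n → (n : k) = 0 → eval₂ (Int.castRingHom k) x g = 0 →
        s * quartic a b c d = g * g * A + C n * g * B + C n * u → eval₂ (Int.castRingHom k) x u = 0) → False) :
    IsMonogenicPoly (quartic a b c d) := by
  refine isMonogenicPoly_of_notMem_sq (quartic_monic a b c d) hirr fun m hm hfm hf2 => ?_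
  -- The field is `ℤ[X]/m` with `x` the class of `X`, so evaluating at `x` is reducing modulo `m`.
  let _ := Ideal.Quotient.field m
  let x : ℤ[X] ⧸ m := Ideal.Quotient.mk m X
  have hx : eval₂RingHom (Int.castRingHom (ℤ[X] ⧸ m)) x = Ideal.Quotient.mk m :=
    Polynomial.ringHom_ext' (RingHom.ext_int _ _) (by simp [x])
  have hmem : ∀ p : ℤ[X], eval₂ (Int.castRingHom (ℤ[X] ⧸ m)) x p = 0 ↔ p ∈ m := fun p => by
    rw [← Ideal.Quotient.eq_zero_iff_mem, ← hx, coe_eval₂RingHom]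
  refine H _ x ?_ ?_ ?_
  · simpa [quartic] using (hmem _).2 hfm
  · have := (hmem _).2 (derivative_mem_of_mem_sq hf2)
    simp [quartic, eval₂_add, eval₂_mul] at this
    linear_combination this
  · intro n s g A B u hn hn0 hg h
    by_contra hu
    rw [hmem] at hu hg
    have hnm : C n ∈ m := (hmem _).1 (by simpa using hn0)
    refine C_mul_notMem_sq (quartic_monic a b c d) hm hfm hn hu ?_
    have h1 : C n * u = s * quartic a b c d - (g * g * A + C n * g * B) := by
      linear_combination -h
    rw [h1]
    refine Ideal.sub_mem _ (Ideal.mul_mem_left _ _ hf2) (Ideal.add_mem _ ?_ ?_) <;>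
      rw [sq]
    · exact Ideal.mul_mem_right _ _ (Ideal.mul_mem_mul hg hg)
    · exact Ideal.mul_mem_right _ _ (Ideal.mul_mem_mul hnm hg)

/-- Taylor expansion at `r`: the linear coefficient is divisible by `p` and the constant one by
`p²`. -/
theorem not_isMonogenicPoly_quartic_of_root {a b c d p r : ℤ} (hp : ¬ IsUnit p) (hp0 : p ≠ 0)
    (h1 : p ∣ 4 * r ^ 3 + 3 * a * r ^ 2 + 2 * b * r + c)
    (h2 : p * p ∣ r ^ 4 + a * r ^ 3 + b * r ^ 2 + c * r + d) :
    ¬ IsMonogenicPoly (quartic a b c d) := by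
  obtain ⟨k, hk⟩ := h1
  obtain ⟨l, hl⟩ := h2
  refine not_isMonogenicPoly_of_root (A := X ^ 2 + C (2 * r + a) * X + C (3 * r ^ 2 + 2 * a * r + b))
    (r := r) (k := k) (l := l) hp hp0 (by monicity!) ?_
  rw [← hk, sq p, ← hl]
  simp [quartic]
  ring

theorem not_isSquare_sq_mul {k m : ℤ} (hk : k ≠ 0) (hm : ¬ IsSquare m) : ¬ IsSquare (k ^ 2 * m) := by
  rintro ⟨r, hr⟩
  have hkr : k ∣ r := by
    rw [← Int.pow_dvd_pow_iff two_ne_zero]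
    exact ⟨m, by rw [sq r, hr]⟩
  obtain ⟨s, rfl⟩ := hkr
  exact hm ⟨s, mul_left_cancel₀ (pow_ne_zero 2 hk) (by linear_combination hr)⟩

theorem not_isSquare_of_emod_four {m : ℤ} (hm : m % 4 = 2 ∨ m % 4 = 3) : ¬ IsSquare m := by
  rintro ⟨r, rfl⟩
  have : r % 4 = 0 ∨ r % 4 = 1 ∨ r % 4 = 2 ∨ r % 4 = 3 := by lia
  rcases this with h | h | h | h <;> simp [Int.mul_emod, h] at hm

theorem not_isSquare_of_emod_eight {m : ℤ} (hm : m % 8 = 5) : ¬ IsSquare m := by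
  rintro ⟨r, rfl⟩
  have : r % 8 = 0 ∨ r % 8 = 1 ∨ r % 8 = 2 ∨ r % 8 = 3 ∨ r % 8 = 4 ∨ r % 8 = 5 ∨ r % 8 = 6 ∨
    r % 8 = 7 := by lia
  rcases this with h | h | h | h | h | h | h | h <;> simp [Int.mul_emod, h] at hm

/-! ### Squarefree values of linear forms. -/

theorem squarefree_mul_iff_of_isCoprime {m n : ℤ} (h : IsCoprime m n) :
    Squarefree (m * n) ↔ Squarefree m ∧ Squarefree n := by
  rw [squarefree_mul_iff]
  exact ⟨fun h => h.2, fun h' => ⟨h.isRelPrime, h'⟩⟩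

theorem squarefree_int_of_odd {n : ℤ} (hn : n % 2 = 1)
    (h : ∀ p : ℕ, p.Prime → p ≠ 2 → ¬ ((p ^ 2 : ℕ) : ℤ) ∣ n) : Squarefree n := by
  rw [← Int.squarefree_natAbs, Nat.squarefree_iff_prime_squarefree]
  intro p hp hd
  rw [← sq, ← Int.natCast_dvd] at hd
  by_cases h2 : p = 2
  · subst h2
    push_cast at hd
    lia
  · exact h p hp h2 hd

theorem exists_cover_linear {a b : ℤ} (hab : IsCoprime a b) {p : ℕ} (hp : p.Prime) (N : ℕ) :
    ∃ s : Finset ℕ, (∀ t ∈ Finset.Icc 1 N, ((p ^ 2 : ℕ) : ℤ) ∣ a * t + b → t ∈ s) ∧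
      s.card ≤ N / p ^ 2 + 1 := by
  classical
  have hpp : Prime (p : ℤ) := Nat.prime_iff_prime_int.1 hp
  by_cases hpa : (p : ℤ) ∣ a
  · refine ⟨∅, fun t _ hd => ?_, by simp⟩
    exfalso
    have h1 : (p : ℤ) ∣ a * t + b := (Dvd.intro _ (by push_cast; ring)).trans hd
    have h2 : (p : ℤ) ∣ b := (dvd_add_right (hpa.mul_right _)).1 h1
    exact hpp.not_isUnit (hab.isUnit_of_dvd' hpa h2)
  · refine ⟨_, fun t ht hd => Finset.mem_filter.2 ⟨ht, hd⟩, card_Icc_filter_dvd_le ?_ N⟩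
    push_cast
    exact ((Prime.coprime_iff_not_dvd hpp).2 hpa).symm.pow_right

theorem prime_le_of_sq_dvd {p : ℕ} {n : ℤ} (hn : n % 2 = 1) {M : ℕ}
    (hd : ((p ^ 2 : ℕ) : ℤ) ∣ n) (hM : n.natAbs ≤ M ^ 2) : p ≤ M := by
  have h1 := Nat.le_of_dvd (by lia) (Int.natCast_dvd.1 hd)
  exact (Nat.pow_le_pow_iff_left two_ne_zero).1 (h1.trans hM)

/-- Three coprime integral linear forms with odd values are infinitely often simultaneously
squarefree. -/
theorem infinite_squarefree_linear {a₁ b₁ a₂ b₂ a₃ b₃ : ℤ}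
    (h₁ : IsCoprime a₁ b₁) (h₂ : IsCoprime a₂ b₂) (h₃ : IsCoprime a₃ b₃)
    (ho₁ : a₁ % 2 = 0) (ho₂ : a₂ % 2 = 0) (ho₃ : a₃ % 2 = 0) :
    {t : ℤ | Squarefree (a₁ * t + b₁) ∧ Squarefree (a₂ * t + b₂) ∧
      Squarefree (a₃ * t + b₃)}.Infinite := by
  classical
  have hodd : ∀ {a b : ℤ}, IsCoprime a b → a % 2 = 0 → ∀ t : ℤ, (a * t + b) % 2 = 1 := by
    intro a b h ho t
    have hb : ¬ (2 : ℤ) ∣ b := fun hb =>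
      Int.prime_two.not_isUnit (h.isUnit_of_dvd' (Int.dvd_of_emod_eq_zero ho) hb)
    have : a * t % 2 = 0 := by rw [Int.mul_emod, ho]; simp
    lia
  -- For `1 ≤ t ≤ N` each form is at most `M N ≤ (M N)²` in absolute value, so `p²` dividing its
  -- value forces `p ≤ M N`. The final `1` keeps `M` positive.
  let M := a₁.natAbs + b₁.natAbs + a₂.natAbs + b₂.natAbs + a₃.natAbs + b₃.natAbs + 1
  have hle : ∀ {a b : ℤ}, a.natAbs + b.natAbs ≤ M → ∀ t N : ℕ, 1 ≤ t → t ≤ N →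
      (a * t + b).natAbs ≤ (M * N) ^ 2 := by
    intro a b h t N h1 h2
    calc (a * t + b).natAbs ≤ (a * t).natAbs + b.natAbs := Int.natAbs_add_le _ _
      _ = a.natAbs * t + b.natAbs := by rw [Int.natAbs_mul, Int.natAbs_natCast]
      _ ≤ a.natAbs * N + b.natAbs * N :=
        Nat.add_le_add (Nat.mul_le_mul_left _ h2) (Nat.le_mul_of_pos_right _ (h1.trans h2))
      _ = (a.natAbs + b.natAbs) * N := (add_mul _ _ _).symm
      _ ≤ M * N := Nat.mul_le_mul_right _ h
      _ ≤ (M * N) ^ 2 := Nat.le_self_pow two_ne_zero _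
  have hinf := infinite_not_bad (fun p t => ((p ^ 2 : ℕ) : ℤ) ∣ a₁ * t + b₁ ∨
    ((p ^ 2 : ℕ) : ℤ) ∣ a₂ * t + b₂ ∨ ((p ^ 2 : ℕ) : ℤ) ∣ a₃ * t + b₃) (c := M) (by lia) ?_ ?_
  · refine (hinf.image (f := ((↑) : ℕ → ℤ)) Nat.cast_injective.injOn).mono ?_
    rintro _ ⟨t, ht, rfl⟩
    refine ⟨squarefree_int_of_odd (hodd h₁ ho₁ t) fun p hp h2 hd => ht p hp h2 (.inl hd),
      squarefree_int_of_odd (hodd h₂ ho₂ t) fun p hp h2 hd => ht p hp h2 (.inr (.inl hd)),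
      squarefree_int_of_odd (hodd h₃ ho₃ t) fun p hp h2 hd => ht p hp h2 (.inr (.inr hd))⟩
  · intro p hp _ N
    obtain ⟨s₁, hs₁, hc₁⟩ := exists_cover_linear h₁ hp N
    obtain ⟨s₂, hs₂, hc₂⟩ := exists_cover_linear h₂ hp N
    obtain ⟨s₃, hs₃, hc₃⟩ := exists_cover_linear h₃ hp N
    refine ⟨s₁ ∪ s₂ ∪ s₃, ?_, ?_⟩
    · rintro t ht (h | h | h)
      · simp [hs₁ t ht h]
      · simp [hs₂ t ht h]
      · simp [hs₃ t ht h]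
    · have := Finset.card_union_le (s₁ ∪ s₂) s₃
      have := Finset.card_union_le s₁ s₂
      lia
  · rintro p t N hp ht1 htN (h | h | h)
    · exact prime_le_of_sq_dvd (hodd h₁ ho₁ t) h (hle (by lia) t N ht1 htN)
    · exact prime_le_of_sq_dvd (hodd h₂ ho₂ t) h (hle (by lia) t N ht1 htN)
    · exact prime_le_of_sq_dvd (hodd h₃ ho₃ t) h (hle (by lia) t N ht1 htN)

theorem quartic_injective {a b c d a' b' c' d' : ℤ} (h : quartic a b c d = quartic a' b' c' d') :
    a = a' ∧ b = b' ∧ c = c' ∧ d = d' := by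
  have := cubic_coeff_eq_zero (e₀ := d - d') (e₁ := c - c') (e₂ := b - b') (e₃ := a - a') (by
    simp only [quartic, C_sub] at h ⊢
    linear_combination h)
  simpa only [sub_eq_zero] using this

/-! ### The family with Galois group `C₂ × C₂` -/

theorem quartic4T2_eq (t : ℤ) : quartic4T2 t = quartic 0 (4 * t) 0 1 := by
  simp [quartic4T2, quartic]

theorem quartic4T2_irreducible (t : ℤ) :
    Irreducible ((quartic4T2 t).map (Int.castRingHom ℚ)) := by
  rw [quartic4T2_eq]
  exact quartic_irreducible_of_shift (by lia) (by lia) (by lia) (by lia) (by lia)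

/-- The identity `f = (x² + 2t)² - (4t² - 1)` handles both directions away from `2`, since `f' =
4x(x² + 2t)`. At `2` the only root is `-1`, and `f(-1) = 2(2t + 1)` is twice an odd number. -/
theorem quartic4T2_isMonogenicPoly_iff (t : ℤ) :
    IsMonogenicPoly (quartic4T2 t) ↔ Squarefree ((2 * t - 1) * (2 * t + 1)) := by
  have hirr := quartic4T2_irreducible t
  rw [quartic4T2_eq] at hirr ⊢
  constructor
  · intro hm p hp
    by_contra hu
    have hp0 : p ≠ 0 := by
      rintro rfl
      rw [zero_mul, zero_dvd_iff, mul_eq_zero] at hp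
      lia
    obtain ⟨k, hk⟩ := hp
    refine not_isMonogenicPoly (f := quartic 0 (4 * t) 0 1) (g := X ^ 2 + C (2 * t)) (A := 1)
      (B := 0) (D := C (-k)) hu hp0 monic_one (by monicity!) ?_ ?_ hm
    · rw [quartic_natDegree, mul_one]
      exact lt_of_le_of_lt (b := 2) (by compute_degree) (by norm_num)
    · have hk' := congrArg (C : ℤ → ℤ[X]) hk
      simp [quartic] at hk' ⊢
      linear_combination -hk'
  · intro hsq
    refine isMonogenicPoly_quartic_of_forall_field hirr fun k _ x h0 h1 H => ?_
    push_cast at h0 h1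
    by_cases h2 : (2 : k) = 0
    · have hx : x + 1 = 0 := pow_eq_zero_iff (n := 4) (by norm_num) |>.1 (by
        linear_combination h0 + (2 * x ^ 3 + 3 * x ^ 2 + 2 * x - 2 * t * x ^ 2) * h2)
      have := H 2 1 (X + 1) ((X + 1) ^ 2 - 4 * (X + 1) + (6 + C (4 * t))) (C (-2 - 4 * t))
        (C (2 * t + 1)) Int.prime_two.squarefree (by exact_mod_cast h2) (by simpa using hx)
        (by simp [quartic]; ring)
      simp at this
      exact one_ne_zero (by linear_combination this - t * h2 : (1 : k) = 0)
    · have hx : x ≠ 0 := by rintro rfl; simp at h0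
      have hg : x ^ 2 + 2 * t = 0 := by
        have : 2 * (2 * (x * (x ^ 2 + 2 * t))) = 0 := by linear_combination h1
        simpa [h2, hx] using this
      have := H _ 1 (X ^ 2 + C (2 * t)) 1 0 (-1) hsq
        (by push_cast; linear_combination (x ^ 2 + 2 * t) * hg - h0) (by simpa using hg)
        (by simp [quartic]; ring)
      simp at this

theorem quarticDisc_quartic4T2 (t : ℤ) :
    quarticDisc 0 (4 * t) 0 1 = 256 * (4 * t ^ 2 - 1) ^ 2 := by
  unfold quarticDisc; ring

theorem im_eq_zero_of_sq_eq {z : ℂ} {r : ℝ} (hr : 0 < r) (h : z ^ 2 = r) : z.im = 0 := by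
  have h1 := congrArg Complex.re h
  have h2 := congrArg Complex.im h
  simp only [sq, Complex.mul_re, Complex.mul_im, Complex.ofReal_re, Complex.ofReal_im] at h1 h2
  have h3 : z.re * z.im = 0 := by linear_combination h2 / 2
  rcases mul_eq_zero.1 h3 with h3 | h3
  · rw [h3] at h1
    nlinarith [mul_self_nonneg z.im]
  · exact h3

/-- For `t < 0` all roots of `x⁴ + 4 t x² + 1` are real. -/
theorem quartic4T2_adjoin_real {t : ℤ} (ht : t < 0) {θ : ℂ} (hθ : aeval θ (quartic4T2 t) = 0)
    (z : ℚ⟮θ⟯) : (z : ℂ).im = 0 := by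
  rw [quartic4T2_eq, aeval_quartic] at hθ
  push_cast at hθ
  have hθ0 : θ ≠ 0 := by
    rintro rfl
    simp at hθ
  have ht' : (t : ℝ) ≤ -1 := by exact_mod_cast (by lia : t ≤ -1)
  have h1 : (θ + θ⁻¹).im = 0 := by
    refine im_eq_zero_of_sq_eq (r := 2 - 4 * t) (by linarith) ?_
    push_cast
    field_simp
    linear_combination hθ
  have h2 : (θ - θ⁻¹).im = 0 := by
    refine im_eq_zero_of_sq_eq (r := -2 - 4 * t) (by linarith) ?_
    push_cast
    field_simp
    linear_combination hθ
  have hθr : θ.im = 0 := by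
    rw [Complex.add_im] at h1
    rw [Complex.sub_im] at h2
    linarith
  have hle : ℚ⟮θ⟯ ≤ (Complex.ofRealAm.restrictScalars ℚ).fieldRange := by
    rw [adjoin_simple_le_iff]
    exact ⟨θ.re, Complex.ext rfl hθr.symm⟩
  obtain ⟨r, hr⟩ := hle z.2
  rw [← hr]
  exact Complex.ofReal_im r

/-- For a root `a` of `f_t`, `(a + a⁻¹)² = 2 - 4t` is negative, so the field does not embed in `ℝ`,
whereas that of `f_{-t}` is real. -/
theorem quartic4T2_distinct_of_pos {t : ℤ} (ht : 0 < t) :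
    GenerateDistinctFields (quartic4T2 t) (quartic4T2 (-t)) := by
  intro α β hα hβ
  refine ⟨fun e => ?_⟩
  have hα' := aeval_gen_eq_zero hα
  set a := AdjoinSimple.gen ℚ α
  rw [quartic4T2_eq, aeval_quartic] at hα'
  push_cast at hα'
  have ha0 : a ≠ 0 := by
    intro h
    simp [h] at hα'
  have h1 : (a + a⁻¹) ^ 2 = ((2 - 4 * t : ℤ) : ℚ⟮α⟯) := by
    push_cast
    field_simp
    linear_combination hα'
  have h2 : (e (a + a⁻¹)) ^ 2 = ((2 - 4 * t : ℤ) : ℚ⟮β⟯) := by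
    rw [← map_pow, h1, map_intCast]
  have h3 : ((e (a + a⁻¹) : ℚ⟮β⟯) : ℂ) ^ 2 = ((2 - 4 * t : ℤ) : ℂ) := by
    have := congrArg (algebraMap ℚ⟮β⟯ ℂ) h2
    rwa [map_pow, map_intCast] at this
  have h4 := quartic4T2_adjoin_real (by lia) hβ (e (a + a⁻¹))
  have h5 := congrArg Complex.re h3
  rw [sq, Complex.mul_re, h4, Complex.intCast_re] at h5
  have h6 : ((2 - 4 * t : ℤ) : ℝ) < 0 := by exact_mod_cast (by lia)
  nlinarith [mul_self_nonneg ((e (a + a⁻¹) : ℚ⟮β⟯) : ℂ).re]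

theorem GenerateDistinctFields.symm {f g : ℤ[X]} (h : GenerateDistinctFields f g) :
    GenerateDistinctFields g f :=
  fun α β hα hβ => ⟨fun e => (h β α hβ hα).false e.symm⟩

theorem quartic4T2_distinct {s t : ℤ} (hs : IsMonogenicPoly (quartic4T2 s))
    (ht : IsMonogenicPoly (quartic4T2 t)) (hst : s ≠ t) :
    GenerateDistinctFields (quartic4T2 s) (quartic4T2 t) := by
  by_cases hneg : t = -s
  · subst hneg
    rcases lt_trichotomy s 0 with h | h | h
    · have := (quartic4T2_distinct_of_pos (t := -s) (by lia)).symm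
      rwa [neg_neg] at this
    · exact absurd (by lia) hst
    · exact quartic4T2_distinct_of_pos h
  · intro α β hα hβ
    rw [quartic4T2_eq] at hs ht hα hβ
    refine ⟨fun e => ?_⟩
    have h := quarticDisc_eq_of_ringEquiv hs ht hα hβ e
    rw [quarticDisc_quartic4T2, quarticDisc_quartic4T2] at h
    have h' : (s - t) * (s + t) * (4 * s ^ 2 + 4 * t ^ 2 - 2) = 0 := by
      linarith
    have h3 : 4 * s ^ 2 + 4 * t ^ 2 - 2 ≠ 0 := by lia
    have h1 : s - t ≠ 0 := by lia
    have h2 : s + t ≠ 0 := by lia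
    exact mul_ne_zero (mul_ne_zero h1 h2) h3 h'

theorem quartic4T2_gal (t : ℤ) : Nonempty (GaloisGroupOverQ (quartic4T2 t) ≃* Group4T2) := by
  have := quartic4T2_irreducible t
  rw [quartic4T2_eq] at this ⊢
  exact gal_mulEquiv_klein this

theorem quartic4T2_family : IsInfiniteFamilyOfMonogenicQuartics Group4T2 quartic4T2
    {t : ℤ | Squarefree (4 * t ^ 2 - 1)} := by
  have hmono : ∀ t ∈ {t : ℤ | Squarefree (4 * t ^ 2 - 1)}, IsMonogenicPoly (quartic4T2 t) := by
    intro t ht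
    rw [quartic4T2_isMonogenicPoly_iff, show (2 * t - 1) * (2 * t + 1) = 4 * t ^ 2 - 1 by ring]
    exact ht
  refine isInfiniteFamily ?_ ?_ (fun t => ?_) hmono quartic4T2_gal
    fun s hs t ht => quartic4T2_distinct (hmono s hs) (hmono t ht)
  -- Only two forms are needed; the third is the constant `1`.
  · refine (infinite_squarefree_linear (a₁ := 2) (b₁ := -1) (a₂ := 2) (b₂ := 1) (a₃ := 0) (b₃ := 1)
      (by norm_num) (by norm_num) (by norm_num) rfl rfl rfl).mono ?_
    rintro t ⟨h1, h2, -⟩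
    change Squarefree (4 * t ^ 2 - 1)
    rw [show 4 * t ^ 2 - 1 = (2 * t + -1) * (2 * t + 1) by ring,
      squarefree_mul_iff_of_isCoprime ⟨t, 1 - t, by ring⟩]
    exact ⟨h1, h2⟩
  · intro s t h
    rw [quartic4T2_eq, quartic4T2_eq] at h
    linarith [(quartic_injective h).2.1]
  · rw [quartic4T2_eq, quartic_natDegree]

/-! ### The family with Galois group `D₄` -/

theorem quartic4T3_eq (t : ℤ) : quartic4T3 t = quartic (24 * t) (12 * t + 4) 4 1 := by
  simp [quartic4T3, quartic]

theorem quartic4T3_irreducible (t : ℤ) :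
    Irreducible ((quartic4T3 t).map (Int.castRingHom ℚ)) := by
  rw [quartic4T3_eq]
  exact quartic_irreducible_of_shift (by lia) (by lia) (by lia) (by lia) (by lia)

theorem isCoprime_six_mul_sub_one_add_one (t : ℤ) : IsCoprime (6 * t - 1) (6 * t + 1) :=
  ⟨3 * t, 1 - 3 * t, by ring⟩

/-- Modulo `6t - 1` the quartic is `(x + 1)⁴`, with `f(-1) = -2(6t - 1)` and `f'(-1) = 8(6t - 1)`.
Modulo `6t + 1` it is a square: `f = (x² - 2x - 1)² + 2(6t + 1)x²(2x + 1)`. -/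
theorem quartic4T3_isMonogenicPoly_iff (t : ℤ) :
    IsMonogenicPoly (quartic4T3 t) ↔ Squarefree ((6 * t - 1) * (6 * t + 1)) := by
  have hirr := quartic4T3_irreducible t
  rw [quartic4T3_eq] at hirr ⊢
  rw [squarefree_mul_iff_of_isCoprime (isCoprime_six_mul_sub_one_add_one t)]
  constructor
  · intro hm
    refine ⟨fun p hp => ?_, fun p hp => ?_⟩ <;> by_contra hu
    · have hp0 : p ≠ 0 := by
        rintro rfl
        rw [zero_mul, zero_dvd_iff] at hp
        lia
      obtain ⟨k, hk⟩ := hp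
      exact not_isMonogenicPoly_quartic_of_root (r := -1) hu hp0
        ⟨8 * p * k, by linear_combination 8 * hk⟩ ⟨-2 * k, by linear_combination -2 * hk⟩ hm
    · have hp0 : p ≠ 0 := by
        rintro rfl
        rw [zero_mul, zero_dvd_iff] at hp
        lia
      obtain ⟨k, hk⟩ := hp
      refine not_isMonogenicPoly (f := quartic (24 * t) (12 * t + 4) 4 1)
        (g := X ^ 2 + (C (-2) * X + C (-1))) (A := 1) (B := 0)
        (D := C (2 * k) * X ^ 2 * (2 * X + 1)) hu hp0 monic_one (by monicity!) ?_ ?_ hm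
      · rw [quartic_natDegree, mul_one]
        exact lt_of_le_of_lt (b := 2) (by compute_degree) (by norm_num)
      · have hk' := congrArg (C : ℤ → ℤ[X]) hk
        simp [quartic] at hk' ⊢
        linear_combination 2 * X ^ 2 * (2 * X + 1) * hk'
  · rintro ⟨hsq1, hsq2⟩
    refine isMonogenicPoly_quartic_of_forall_field hirr fun k _ x h0 h1 H => ?_
    push_cast at h0 h1
    -- A Bézout relation between `f` and `f'`: a double root can only occur where `8(36t² - 1)`
    -- vanishes.
    have hdisc : 2 * (2 * (2 * ((6 * t - 1 : k) * (6 * t + 1)))) = 0 := by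
      linear_combination (-132 + 240 * t + 288 * t ^ 2 + (28 - 1080 * t + 864 * t ^ 2) * x +
        (-60 + 48 * t) * x ^ 2) * h0 + (31 - 60 * t + (63 - 36 * t - 144 * t ^ 2) * x +
        (-7 + 360 * t - 288 * t ^ 2) * x ^ 2 + (15 - 12 * t) * x ^ 3) * h1
    by_cases h2 : (2 : k) = 0
    · have hx : x + 1 = 0 := pow_eq_zero_iff (n := 4) (by norm_num) |>.1 (by
        linear_combination h0 + (2 * x ^ 3 + 3 * x ^ 2 - 12 * t * x ^ 3 - (6 * t + 2) * x ^ 2) * h2)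
      have := H 2 1 (X + 1) ((X + 1) ^ 2 + C (24 * t - 4) * (X + 1) + C (10 - 60 * t))
        (C (4 * (6 * t - 1))) (C (1 - 6 * t)) Int.prime_two.squarefree (by exact_mod_cast h2)
        (by simpa using hx) (by simp [quartic]; ring)
      simp at this
      exact one_ne_zero (by linear_combination this + 3 * t * h2 : (1 : k) = 0)
    · rcases (by simpa [h2] using hdisc : (6 * t - 1 : k) = 0 ∨ (6 * t + 1 : k) = 0) with h6 | h6
      · have hx : x + 1 = 0 := pow_eq_zero_iff (n := 4) (by norm_num) |>.1 (by
          linear_combination h0 - (4 * x ^ 3 + 2 * x ^ 2) * h6)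
        have := H _ 1 (X + 1) ((X + 1) ^ 2 + C (24 * t - 4) * (X + 1) + C (10 - 60 * t))
          8 (-2) hsq1 (by push_cast; exact h6)
          (by simpa using hx) (by simp [quartic]; ring)
        simp [h2] at this
      · have hg : x ^ 2 - 2 * x - 1 = 0 := pow_eq_zero_iff (n := 2) (by norm_num) |>.1 (by
          linear_combination h0 - (2 * x ^ 2 * (2 * x + 1)) * h6)
        have := H _ 1 (X ^ 2 - 2 * X - 1) 1 0 (2 * X ^ 2 * (2 * X + 1)) hsq2
          (by push_cast; exact h6) (by simpa using hg) (by simp [quartic]; ring)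
        have hx : x ≠ 0 := by rintro rfl; simp at h0
        simp [eval₂_mul, h2, hx] at this
        -- `2x + 1` is a unit where `x² - 2x - 1 = 0`, because `4(x² - 2x - 1) = (2x - 5)(2x + 1) +
        -- 1`.
        exact one_ne_zero (by linear_combination 4 * hg - (2 * x - 5) * this : (1 : k) = 0)

theorem quarticDisc_quartic4T3 (t : ℤ) :
    quarticDisc (24 * t) (12 * t + 4) 4 1 = -512 * (6 * t - 1) ^ 3 * (6 * t + 1) ^ 2 := by
  unfold quarticDisc; ring

theorem quartic4T3_gal (t : ℤ) : Nonempty (GaloisGroupOverQ (quartic4T3 t) ≃* Group4T3) := by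
  have hirr := quartic4T3_irreducible t
  rw [quartic4T3_eq] at hirr ⊢
  have h2 : ¬ IsSquare (2 * (1 - 6 * t)) := not_isSquare_of_emod_four (by lia)
  -- The integral root of the resolvent is `12t`. Up to squares, `β² - 4d` is `36t² - 1`, the
  -- discriminant is `2(1 - 6t)`, and neither these nor their product is a square modulo `4`.
  refine gal_mulEquiv_dihedral (β := 12 * t) hirr (by ring) ?_ ?_ ?_
  · have := not_isSquare_sq_mul (k := 2) (m := 36 * t ^ 2 - 1) two_ne_zero
      (not_isSquare_of_emod_four (by lia))
    convert this using 2
    ring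
  · rw [quarticDisc_quartic4T3]
    have := not_isSquare_sq_mul (k := 16 * (6 * t - 1) * (6 * t + 1)) (by
      refine mul_ne_zero (mul_ne_zero (by norm_num) ?_) ?_ <;> lia) h2
    convert this using 2
    ring
  · rw [quarticDisc_quartic4T3]
    have h3 : ¬ IsSquare (2 * (1 - 6 * t) * (36 * t ^ 2 - 1)) :=
      not_isSquare_of_emod_four (by
        left
        have : 2 * (1 - 6 * t) * (36 * t ^ 2 - 1) =
          4 * (18 * t ^ 2 - 108 * t ^ 3 + 3 * t - 1) + 2 := by ring
        lia)
    have := not_isSquare_sq_mul (k := 32 * (6 * t - 1) * (6 * t + 1)) (by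
      refine mul_ne_zero (mul_ne_zero (by norm_num) ?_) ?_ <;> lia) h3
    convert this using 2
    ring

theorem quartic4T3_distinct {s t : ℤ} (hs : IsMonogenicPoly (quartic4T3 s))
    (ht : IsMonogenicPoly (quartic4T3 t)) (hst : s ≠ t) :
    GenerateDistinctFields (quartic4T3 s) (quartic4T3 t) := by
  intro α β hα hβ
  rw [quartic4T3_eq] at hs ht hα hβ
  refine ⟨fun e => ?_⟩
  have h := quarticDisc_eq_of_ringEquiv hs ht hα hβ e
  rw [quarticDisc_quartic4T3, quarticDisc_quartic4T3] at h
  -- The cofactor of `s - t` is twice an odd number, hence nonzero.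
  have h' : (s - t) * (2 * (3 * 6 ^ 4 * (s ^ 4 + s ^ 3 * t + s ^ 2 * t ^ 2 + s * t ^ 3 + t ^ 4)
    - 3 * 6 ^ 3 * (s ^ 3 + s ^ 2 * t + s * t ^ 2 + t ^ 3) - 6 ^ 3 * (s ^ 2 + s * t + t ^ 2)
    + 36 * (s + t) + 3)) = 0 := by linarith
  rcases mul_eq_zero.1 h' with h' | h' <;> lia

theorem quartic4T3_family : IsInfiniteFamilyOfMonogenicQuartics Group4T3 quartic4T3
    {t : ℤ | Squarefree (36 * t ^ 2 - 1)} := by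
  have hmono : ∀ t ∈ {t : ℤ | Squarefree (36 * t ^ 2 - 1)}, IsMonogenicPoly (quartic4T3 t) := by
    intro t ht
    rw [quartic4T3_isMonogenicPoly_iff, show (6 * t - 1) * (6 * t + 1) = 36 * t ^ 2 - 1 by ring]
    exact ht
  refine isInfiniteFamily ?_ ?_ (fun t => ?_) hmono quartic4T3_gal
    fun s hs t ht => quartic4T3_distinct (hmono s hs) (hmono t ht)
  · refine (infinite_squarefree_linear (a₁ := 6) (b₁ := -1) (a₂ := 6) (b₂ := 1) (a₃ := 0) (b₃ := 1)
      (by norm_num) (by norm_num) (by norm_num) rfl rfl rfl).mono ?_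
    rintro t ⟨h1, h2, -⟩
    change Squarefree (36 * t ^ 2 - 1)
    rw [show 36 * t ^ 2 - 1 = (6 * t - 1) * (6 * t + 1) by ring,
      squarefree_mul_iff_of_isCoprime (isCoprime_six_mul_sub_one_add_one t)]
    exact ⟨h1, h2⟩
  · intro s t h
    rw [quartic4T3_eq, quartic4T3_eq] at h
    linarith [(quartic_injective h).1]
  · rw [quartic4T3_eq, quartic_natDegree]

/-! ### The family with Galois group `S₄` -/

theorem quartic4T5_eq (t : ℤ) : quartic4T5 t = quartic (-2) (-2) 6 (4 * t - 2) := by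
  simp [quartic4T5, quartic]
  ring

theorem quartic4T5_irreducible (t : ℤ) :
    Irreducible ((quartic4T5 t).map (Int.castRingHom ℚ)) := by
  rw [quartic4T5_eq]
  exact quartic_irreducible_of_even (by lia) (by lia) (by lia) (by lia) (by lia)

/-- Since `f' = 2(2x - 3)(x - 1)(x + 1)`, double roots away from `2` are among `1`, `-1` and `3/2`,
where `f(1) = 4t + 1`, `f(-1) = 4t - 7` and `16 f(3/2) = 64t + 13`. -/
theorem quartic4T5_isMonogenicPoly_iff (t : ℤ) :
    IsMonogenicPoly (quartic4T5 t) ↔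
      (Squarefree (4 * t + 1) ∧ Squarefree (4 * t - 7) ∧ Squarefree (64 * t + 13)) := by
  have hirr := quartic4T5_irreducible t
  rw [quartic4T5_eq] at hirr ⊢
  constructor
  · intro hm
    refine ⟨fun p hp => ?_, fun p hp => ?_, fun p hp => ?_⟩ <;> by_contra hu
    · have hp0 : p ≠ 0 := by
        rintro rfl
        rw [zero_mul, zero_dvd_iff] at hp
        lia
      refine not_isMonogenicPoly_quartic_of_root (r := 1) hu hp0 (by norm_num) ?_ hm
      obtain ⟨k, hk⟩ := hp
      exact ⟨k, by linear_combination hk⟩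
    · have hp0 : p ≠ 0 := by
        rintro rfl
        rw [zero_mul, zero_dvd_iff] at hp
        lia
      refine not_isMonogenicPoly_quartic_of_root (r := -1) hu hp0 (by norm_num) ?_ hm
      obtain ⟨k, hk⟩ := hp
      exact ⟨k, by linear_combination hk⟩
    · have hp0 : p ≠ 0 := by
        rintro rfl
        rw [zero_mul, zero_dvd_iff] at hp
        lia
      obtain ⟨k, hk⟩ := hp
      have hodd : (p * p) % 2 = 1 := by
        by_contra hn
        have h2 : (2 : ℤ) ∣ p * p := by lia
        have h3 : (2 : ℤ) ∣ 64 * t + 13 := hk ▸ h2.mul_right k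
        lia
      -- As `p² = 2j + 1`, the integer `3(j + 1)` represents `3/2` modulo `p²`.
      obtain ⟨j, hj⟩ : ∃ j, p * p = 2 * j + 1 := ⟨p * p / 2, by lia⟩
      have hr : 2 * (3 * (j + 1)) - 3 = 3 * (p * p) := by linear_combination -3 * hj
      have hcop : IsCoprime (p * p) 16 := by
        rw [show (16 : ℤ) = 2 ^ 4 by norm_num]
        exact IsCoprime.pow_right ⟨1, -j, by linear_combination hj⟩
      refine not_isMonogenicPoly_quartic_of_root (r := 3 * (j + 1)) hu hp0
        ⟨2 * (3 * p) * ((3 * (j + 1)) ^ 2 - 1), ?_⟩ (hcop.dvd_of_dvd_mul_left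
        ⟨9 * (p * p) * (4 * (3 * (j + 1)) ^ 2 + 4 * (3 * (j + 1)) - 5) + k, ?_⟩) hm
      · linear_combination 2 * ((3 * (j + 1)) ^ 2 - 1) * hr
      · linear_combination hk + (4 * (3 * (j + 1)) ^ 2 + 4 * (3 * (j + 1)) - 5) *
          (2 * (3 * (j + 1)) - 3 + 3 * (p * p)) * hr
  · rintro ⟨hsq1, hsq2, hsq3⟩
    refine isMonogenicPoly_quartic_of_forall_field hirr fun k _ x h0 h1 H => ?_
    push_cast at h0 h1
    by_cases h2 : (2 : k) = 0
    · have hx : x = 0 := pow_eq_zero_iff (n := 4) (by norm_num) |>.1 (by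
        linear_combination h0 + (x ^ 3 + x ^ 2 - 3 * x - 2 * t + 1) * h2)
      have := H 2 1 X (X ^ 2 - 2 * X - 2) 3 (C (2 * t - 1))
        Int.prime_two.squarefree (by exact_mod_cast h2) (by simpa using hx)
        (by simp [quartic]; ring)
      simp at this
      exact one_ne_zero (by linear_combination -this + t * h2 : (1 : k) = 0)
    · have h3 : 2 * ((2 * x - 3) * ((x - 1) * (x + 1))) = 0 := by linear_combination h1
      rcases (by simpa [h2] using h3 : 2 * x - 3 = 0 ∨ x - 1 = 0 ∨ x + 1 = 0) with hx | hx | hx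
      · have := H (64 * t + 13) 16 (2 * X - 3) (4 * X ^ 2 + 4 * X - 5) 0 1 hsq3
          (by push_cast; linear_combination 16 * h0 - (4 * x ^ 2 + 4 * x - 5) * (2 * x - 3) * hx)
          (by simpa using hx) (by simp [quartic]; ring)
        simp at this
      · have := H (4 * t + 1) 1 (X - 1) (X ^ 2 - 3) 0 1 hsq1
          (by push_cast; linear_combination h0 - (x ^ 2 - 3) * (x - 1) * hx)
          (by simpa using hx) (by simp [quartic]; ring)
        simp at this
      · have := H (4 * t - 7) 1 (X + 1) (X ^ 2 - 4 * X + 5) 0 1 hsq2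
          (by push_cast; linear_combination h0 - (x ^ 2 - 4 * x + 5) * (x + 1) * hx)
          (by simpa using hx) (by simp [quartic]; ring)
        simp at this

theorem quarticDisc_quartic4T5 (t : ℤ) : quarticDisc (-2) (-2) 6 (4 * t - 2) =
    16 * ((4 * t + 1) * (4 * t - 7) * (64 * t + 13)) := by
  unfold quarticDisc; ring

theorem quartic4T5_gal (t : ℤ) : Nonempty (GaloisGroupOverQ (quartic4T5 t) ≃* Group4T5) := by
  have hirr := quartic4T5_irreducible t
  rw [quartic4T5_eq] at hirr ⊢
  refine gal_mulEquiv_perm hirr (fun y hy => ?_) ?_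
  · have h2 : (2 : ℤ) ∣ y := Int.prime_two.dvd_of_dvd_pow (n := 3)
      ⟨-(y ^ 2 - (8 * t + 2) * y - (24 * t + 6)), by linear_combination hy⟩
    obtain ⟨z, rfl⟩ := h2
    have : 2 * (z ^ 3 + z ^ 2 - (4 * t + 1) * z - (6 * t + 1)) = 1 := by linarith
    lia
  · rw [quarticDisc_quartic4T5]
    refine not_isSquare_sq_mul (k := 4) (by norm_num) (not_isSquare_of_emod_eight ?_)
    have : (4 * t + 1) * (4 * t - 7) * (64 * t + 13) =
      8 * (128 * t ^ 3 - 166 * t ^ 2 - 95 * t - 12) + 5 := by ring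
    lia

theorem quartic4T5_distinct {s t : ℤ} (hs : IsMonogenicPoly (quartic4T5 s))
    (ht : IsMonogenicPoly (quartic4T5 t)) (hst : s ≠ t) :
    GenerateDistinctFields (quartic4T5 s) (quartic4T5 t) := by
  intro α β hα hβ
  rw [quartic4T5_eq] at hs ht hα hβ
  refine ⟨fun e => ?_⟩
  have h := quarticDisc_eq_of_ringEquiv hs ht hα hβ e
  rw [quarticDisc_quartic4T5, quarticDisc_quartic4T5] at h
  -- The cofactor of `s - t` is odd.
  have h' : (s - t) * (2 * (64 * (s ^ 2 + s * t + t ^ 2) - 83 * (s + t)) - 95) = 0 := by linarith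
  rcases mul_eq_zero.1 h' with h' | h' <;> lia

theorem quartic4T5_family : IsInfiniteFamilyOfMonogenicQuartics Group4T5 quartic4T5
    {t : ℤ | Squarefree (4 * t + 1) ∧ Squarefree (4 * t - 7) ∧ Squarefree (64 * t + 13)} := by
  have hmono := fun t => (quartic4T5_isMonogenicPoly_iff t).2
  refine isInfiniteFamily ?_ ?_ (fun t => ?_) hmono quartic4T5_gal
    fun s hs t ht => quartic4T5_distinct (hmono s hs) (hmono t ht)
  · exact infinite_squarefree_linear (a₁ := 4) (b₁ := 1) (a₂ := 4) (b₂ := -7) (a₃ := 64) (b₃ := 13)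
      (by norm_num) (by norm_num) (by norm_num) rfl rfl rfl
  · intro s t h
    rw [quartic4T5_eq, quartic4T5_eq] at h
    linarith [(quartic_injective h).2.2.2]
  · rw [quartic4T5_eq, quartic_natDegree]

/-! ### The family with Galois group `A₄` -/

theorem quartic4T4_eq (t : ℤ) :
    quartic4T4 t = quartic 2 2 (4 * t) (36 * t ^ 2 - 16 * t + 2) := by
  simp [quartic4T4, quartic]

theorem quartic4T4_irreducible (t : ℤ) :
    Irreducible ((quartic4T4 t).map (Int.castRingHom ℚ)) := by
  rw [quartic4T4_eq]
  exact quartic_irreducible_of_even (by lia) (by lia) (by lia) (by lia) (by lia)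

theorem isCoprime_quartic4T4_factors (t : ℤ) :
    IsCoprime (4 * t - 1) (108 * t ^ 2 - 54 * t + 7) :=
  ⟨-27 * (4 * t - 1), 4, by ring⟩

/-- At `4t - 1` the quartic is a square: `f = (x² + x + 2t)² + (4t - 1)(2(4t - 1) - x²)`. At `q =
108t² - 54t + 7` it has the triple root `1 - 6t`: there `f`, `f'` and `f''/2` take the values `(12t²
- 6t + 1)q`, `(2 - 8t)q` and `2q`. -/
theorem quartic4T4_isMonogenicPoly_iff (t : ℤ) :
    IsMonogenicPoly (quartic4T4 t) ↔
      Squarefree ((4 * t - 1) * (108 * t ^ 2 - 54 * t + 7)) := by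
  have hirr := quartic4T4_irreducible t
  rw [quartic4T4_eq] at hirr ⊢
  rw [squarefree_mul_iff_of_isCoprime (isCoprime_quartic4T4_factors t)]
  constructor
  · intro hm
    refine ⟨fun p hp => ?_, fun p hp => ?_⟩ <;> by_contra hu
    · have hp0 : p ≠ 0 := by
        rintro rfl
        rw [zero_mul, zero_dvd_iff] at hp
        lia
      obtain ⟨k, hk⟩ := hp
      refine not_isMonogenicPoly (f := quartic 2 2 (4 * t) (36 * t ^ 2 - 16 * t + 2))
        (g := X ^ 2 + (C 1 * X + C (2 * t))) (A := 1) (B := 0)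
        (D := C k * (C (2 * (4 * t - 1)) - X ^ 2)) hu hp0 monic_one (by monicity!) ?_ ?_ hm
      · rw [quartic_natDegree, mul_one]
        exact lt_of_le_of_lt (b := 2) (by compute_degree) (by norm_num)
      · have hk' := congrArg (C : ℤ → ℤ[X]) hk
        simp [quartic] at hk' ⊢
        linear_combination (2 * (4 * (t : ℤ[X]) - 1) - X ^ 2) * hk'
    · have hp0 : p ≠ 0 := by
        rintro rfl
        rw [zero_mul, zero_dvd_iff] at hp
        lia
      obtain ⟨k, hk⟩ := hp
      exact not_isMonogenicPoly_quartic_of_root (r := 1 - 6 * t) hu hp0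
        ⟨p * k * (2 - 8 * t), by linear_combination (2 - 8 * t) * hk⟩
        ⟨k * (12 * t ^ 2 - 6 * t + 1), by linear_combination (12 * t ^ 2 - 6 * t + 1) * hk⟩ hm
  · rintro ⟨hsq1, hsq2⟩
    refine isMonogenicPoly_quartic_of_forall_field hirr fun k _ x h0 h1 H => ?_
    push_cast at h0 h1
    have hdisc : 2 * (2 * ((4 * t - 1 : k) * (108 * t ^ 2 - 54 * t + 7))) = 0 := by
      linear_combination (-14 + 48 * t - 4 * x) * h0 +
        (2 - 6 * t + (4 - 12 * t) * x + x ^ 2) * h1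
    by_cases h2 : (2 : k) = 0
    · have hx : x = 0 := pow_eq_zero_iff (n := 4) (by norm_num) |>.1 (by
        linear_combination h0 - (x ^ 3 + x ^ 2 + 2 * t * x + 18 * t ^ 2 - 8 * t + 1) * h2)
      have := H 2 1 X (X ^ 2 + 2 * X + 2) (C (2 * t)) (C (18 * t ^ 2 - 8 * t + 1))
        Int.prime_two.squarefree (by exact_mod_cast h2) (by simpa using hx)
        (by simp [quartic]; ring)
      simp [eval₂_pow] at this
      exact one_ne_zero (by linear_combination this - (9 * t ^ 2 - 4 * t) * h2 : (1 : k) = 0)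
    · rcases (by simpa [h2] using hdisc :
        (4 * t - 1 : k) = 0 ∨ (108 * t ^ 2 - 54 * t + 7 : k) = 0) with h4 | hq
      · have hg : x ^ 2 + x + 2 * t = 0 := pow_eq_zero_iff (n := 2) (by norm_num) |>.1 (by
          linear_combination h0 + (x ^ 2 - 2 * (4 * t - 1)) * h4)
        have := H _ 1 (X ^ 2 + X + C (2 * t)) 1 0 (C (2 * (4 * t - 1)) - X ^ 2) hsq1
          (by push_cast; exact h4) (by simpa using hg) (by simp [quartic]; ring)
        simp [h4] at this
        rw [this] at h0
        exact one_ne_zero (by linear_combination 4 * h0 - (36 * t - 7) * h4 : (1 : k) = 0)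
      -- With `y = x - 1 + 6t`, `f` and `f'` reduce to `y³` and `y²` times linear factors that
      -- vanish together only if `y = 0`. So the triple root is the only double root.
      · have hx : x - 1 + 6 * t = 0 := by
          by_contra hy
          have h3 : (x - 1 + 6 * t) ^ 3 * (x + 3 * (1 - 6 * t) + 2) = 0 := by
            linear_combination h0 - (2 * (x - 1 + 6 * t) ^ 2 + (2 - 8 * t) * (x - 1 + 6 * t) +
              (12 * t ^ 2 - 6 * t + 1)) * hq
          have h4 : (x - 1 + 6 * t) ^ 2 * (4 * x + 8 * (1 - 6 * t) + 6) = 0 := by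
            linear_combination h1 - (4 * (x - 1 + 6 * t) + (2 - 8 * t)) * hq
          have h5 := (mul_eq_zero.1 h3).resolve_left (pow_ne_zero _ hy)
          have h6 := (mul_eq_zero.1 h4).resolve_left (pow_ne_zero _ hy)
          exact hy (by linear_combination h6 - 3 * h5)
        have := H _ 1 (X - C (1 - 6 * t))
          ((X - C (1 - 6 * t)) ^ 2 + C (4 * (1 - 6 * t) + 2) * (X - C (1 - 6 * t)))
          (2 * (X - C (1 - 6 * t)) + C (2 - 8 * t)) (C (12 * t ^ 2 - 6 * t + 1)) hsq2
          (by push_cast; exact hq) (by simp; linear_combination hx) (by simp [quartic]; ring)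
        simp [eval₂_pow] at this
        -- The cofactor is a unit because `9(12t² - 6t + 1) - q = 2`.
        exact h2 (by linear_combination 9 * this - hq)

theorem quarticDisc_quartic4T4 (t : ℤ) :
    quarticDisc 2 2 (4 * t) (36 * t ^ 2 - 16 * t + 2) =
      64 * ((4 * t - 1) * (108 * t ^ 2 - 54 * t + 7)) ^ 2 := by
  unfold quarticDisc; ring

theorem quartic4T4_gal (t : ℤ) : Nonempty (GaloisGroupOverQ (quartic4T4 t) ≃* Group4T4) := by
  have hirr := quartic4T4_irreducible t
  rw [quartic4T4_eq] at hirr ⊢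
  refine gal_mulEquiv_alternating hirr (fun y hy => ?_) ?_
  · have h2 : (2 : ℤ) ∣ y := Int.prime_two.dvd_of_dvd_pow (n := 3)
      ⟨y ^ 2 + 4 * (18 * t ^ 2 - 9 * t + 1) * y - 4 * (4 * t - 1) ^ 2, by linear_combination hy⟩
    obtain ⟨z, rfl⟩ := h2
    have h3 : z ^ 3 - z ^ 2 + 2 * (8 * t ^ 2 - 4 * t - (18 * t ^ 2 - 9 * t + 1) * z) = -1 := by
      linarith
    -- A root of the resolvent is even, `y = 2z`, and what remains of the equation contradicts this
    -- parity.
    have h4 : Even (z ^ 3 - z ^ 2) := by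
      rw [show z ^ 3 - z ^ 2 = z * ((z - 1) * z) by ring]
      exact (Int.even_mul_pred_self z).mul_left z |> fun h => by rwa [mul_comm (z - 1) z]
    obtain ⟨w, hw⟩ := h4
    lia
  · rw [quarticDisc_quartic4T4]
    exact ⟨8 * ((4 * t - 1) * (108 * t ^ 2 - 54 * t + 7)), by ring⟩

/-- With `w = 4t - 1` the square root of the discriminant is, up to a constant, `27w³ + w`, an odd
injective function. So `w` is determined up to sign, and opposite signs would require `2(s + t) =
1`. -/
theorem quartic4T4_distinct {s t : ℤ} (hs : IsMonogenicPoly (quartic4T4 s))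
    (ht : IsMonogenicPoly (quartic4T4 t)) (hst : s ≠ t) :
    GenerateDistinctFields (quartic4T4 s) (quartic4T4 t) := by
  intro α β hα hβ
  rw [quartic4T4_eq] at hs ht hα hβ
  refine ⟨fun e => ?_⟩
  have h := quarticDisc_eq_of_ringEquiv hs ht hα hβ e
  rw [quarticDisc_quartic4T4, quarticDisc_quartic4T4] at h
  have h1 : ((4 * s - 1) * (108 * s ^ 2 - 54 * s + 7)) ^ 2 =
    ((4 * t - 1) * (108 * t ^ 2 - 54 * t + 7)) ^ 2 := by linarith
  rcases sq_eq_sq_iff_eq_or_eq_neg.1 h1 with h1 | h1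
  · have h2 : (s - t) * (27 * ((4 * s - 1) ^ 2 + (4 * s - 1) * (4 * t - 1) + (4 * t - 1) ^ 2) + 1) = 0 := by
      linarith
    rcases mul_eq_zero.1 h2 with h2 | h2
    · lia
    · nlinarith [sq_nonneg (4 * s - 1 + (4 * t - 1)), sq_nonneg (4 * s - 1), sq_nonneg (4 * t - 1)]
  · have h2 : (2 * (s + t) - 1) *
      (27 * ((4 * s - 1) ^ 2 - (4 * s - 1) * (4 * t - 1) + (4 * t - 1) ^ 2) + 1) = 0 := by
      linarith
    rcases mul_eq_zero.1 h2 with h2 | h2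
    · lia
    · nlinarith [sq_nonneg (4 * s - 1 - (4 * t - 1)), sq_nonneg (4 * s - 1), sq_nonneg (4 * t - 1)]

/-- If `r` is one zero modulo `p²`, every other zero `t` satisfies `p² ∣ 54(t - r)(2t + 2r - 1)`.
Here `p` does not divide `54`, and it cannot divide both other factors, as it would then divide `4t
- 1`, which is coprime to the quadratic. So the zeros lie in two residue classes. -/
theorem exists_cover_quadratic {p : ℕ} (hp : p.Prime) (N : ℕ) :
    ∃ s : Finset ℕ, (∀ t ∈ Finset.Icc 1 N,
        ((p ^ 2 : ℕ) : ℤ) ∣ 108 * (t : ℤ) ^ 2 - 54 * t + 7 → t ∈ s) ∧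
      s.card ≤ 2 * (N / p ^ 2 + 1) := by
  classical
  by_cases h : ∃ r : ℕ, ((p ^ 2 : ℕ) : ℤ) ∣ 108 * (r : ℤ) ^ 2 - 54 * r + 7
  · obtain ⟨r, hr⟩ := h
    obtain ⟨s₁, hs₁, hc₁⟩ := exists_cover_linear (a := 1) (b := -r) isCoprime_one_left hp N
    obtain ⟨s₂, hs₂, hc₂⟩ := exists_cover_linear (a := 2) (b := 2 * r - 1)
      ⟨r, -1, by ring⟩ hp N
    refine ⟨s₁ ∪ s₂, fun t ht hd => ?_, (Finset.card_union_le _ _).trans (by lia)⟩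
    have hpp : Prime (p : ℤ) := Nat.prime_iff_prime_int.1 hp
    have hpd : (p : ℤ) ∣ ((p ^ 2 : ℕ) : ℤ) := ⟨p, by push_cast; ring⟩
    have hdvd : (p : ℤ) ^ 2 ∣ (54 * (1 * (t : ℤ) + -r)) * (2 * t + (2 * r - 1)) := by
      obtain ⟨k, hk⟩ := dvd_sub hd hr
      push_cast at hk
      exact ⟨k, by linear_combination hk⟩
    have hpq : ¬ (p : ℤ) ∣ 4 * t - 1 := fun h => hpp.not_isUnit
      ((isCoprime_quartic4T4_factors t).isUnit_of_dvd' h (hpd.trans hd))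
    have hp54 : IsCoprime ((p : ℤ) ^ 2) 54 := by
      refine IsCoprime.pow_left (hpp.coprime_iff_not_dvd.2 fun h => ?_)
      have h1 : (p : ℤ) ∣ 7 := by
        have := dvd_sub (hpd.trans hd) (h.mul_right (2 * (t : ℤ) ^ 2 - t))
        ring_nf at this
        exact this
      exact hpp.not_isUnit (IsCoprime.isUnit_of_dvd' (a := 54) (b := 7) (by norm_num) h h1)
    rw [Finset.mem_union]
    by_cases h1 : (p : ℤ) ∣ 1 * t + -r
    · have h2 : ¬ (p : ℤ) ∣ 2 * t + (2 * r - 1) := fun h2 => hpq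
        ((by ring : 2 * t + (2 * r - 1) + 2 * (1 * t + -r) = 4 * (t : ℤ) - 1) ▸
          dvd_add h2 (h1.mul_left 2))
      refine .inl (hs₁ t ht ?_)
      push_cast
      exact hp54.dvd_of_dvd_mul_left
        ((hpp.coprime_iff_not_dvd.2 h2).pow_left.dvd_of_dvd_mul_right hdvd)
    · refine .inr (hs₂ t ht ?_)
      push_cast
      exact (hp54.mul_right (hpp.coprime_iff_not_dvd.2 h1).pow_left).dvd_of_dvd_mul_left hdvd
  · exact ⟨∅, fun t _ hd => absurd ⟨t, hd⟩ h, by simp⟩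

theorem infinite_squarefree_quartic4T4 :
    {t : ℤ | Squarefree ((4 * t - 1) * (108 * t ^ 2 - 54 * t + 7))}.Infinite := by
  -- The constant `11` works because `108t² - 54t + 7 ≤ 121N²` for `1 ≤ t ≤ N`.
  have hinf := infinite_not_bad (fun p t => ((p ^ 2 : ℕ) : ℤ) ∣ 4 * t + -1 ∨
    ((p ^ 2 : ℕ) : ℤ) ∣ 108 * (t : ℤ) ^ 2 - 54 * t + 7) (c := 11) (by lia) ?_ ?_
  · refine (hinf.image (f := ((↑) : ℕ → ℤ)) Nat.cast_injective.injOn).mono ?_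
    rintro _ ⟨t, ht, rfl⟩
    refine (squarefree_mul_iff_of_isCoprime (isCoprime_quartic4T4_factors t)).2
      ⟨squarefree_int_of_odd (by lia) fun p hp h2 hd => ht p hp h2 (.inl hd),
      squarefree_int_of_odd (by lia) fun p hp h2 hd => ht p hp h2 (.inr hd)⟩
  · intro p hp _ N
    obtain ⟨s₁, hs₁, hc₁⟩ := exists_cover_linear (a := 4) (b := -1) (by norm_num) hp N
    obtain ⟨s₂, hs₂, hc₂⟩ := exists_cover_quadratic hp N
    classical
    refine ⟨s₁ ∪ s₂, ?_, (Finset.card_union_le _ _).trans (by lia)⟩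
    rintro t ht (h | h)
    · simp [hs₁ t ht h]
    · simp [hs₂ t ht h]
  · rintro p t N hp ht1 htN (h | h)
    · refine prime_le_of_sq_dvd (by lia) h ?_
      have : (4 * (t : ℤ) + -1).natAbs ≤ 4 * t := by lia
      nlinarith
    · refine prime_le_of_sq_dvd (by lia) h ?_
      zify
      have h1 : (1 : ℤ) ≤ t := by exact_mod_cast ht1
      have h2 : (t : ℤ) ≤ N := by exact_mod_cast htN
      rw [abs_of_nonneg (by nlinarith)]
      nlinarith

theorem quartic4T4_family : IsInfiniteFamilyOfMonogenicQuartics Group4T4 quartic4T4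
    {t : ℤ | Squarefree ((4 * t - 1) * (108 * t ^ 2 - 54 * t + 7))} := by
  have hmono := fun t => (quartic4T4_isMonogenicPoly_iff t).2
  refine isInfiniteFamily infinite_squarefree_quartic4T4 ?_ (fun t => ?_) hmono quartic4T4_gal
    fun s hs t ht => quartic4T4_distinct (hmono s hs) (hmono t ht)
  · intro s t h
    rw [quartic4T4_eq, quartic4T4_eq] at h
    linarith [(quartic_injective h).2.2.1]
  · rw [quartic4T4_eq, quartic_natDegree]

/-! ### The main theorem. -/

theorem theorem1p1 :
    -- X = 2
    ((∀ t : ℤ, (quartic4T2 t).Monic ∧ (quartic4T2 t).natDegree = 4 ∧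
        Irreducible ((quartic4T2 t).map (Int.castRingHom ℚ)) ∧
        Nonempty (GaloisGroupOverQ (quartic4T2 t) ≃* Group4T2)) ∧
      (∀ t : ℤ, IsMonogenicPoly (quartic4T2 t) ↔ Squarefree ((2 * t - 1) * (2 * t + 1))) ∧
      IsInfiniteFamilyOfMonogenicQuartics Group4T2 quartic4T2
        {t : ℤ | Squarefree (4 * t ^ 2 - 1)}) ∧
    -- X = 3
    ((∀ t : ℤ, (quartic4T3 t).Monic ∧ (quartic4T3 t).natDegree = 4 ∧
        Irreducible ((quartic4T3 t).map (Int.castRingHom ℚ)) ∧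
        Nonempty (GaloisGroupOverQ (quartic4T3 t) ≃* Group4T3)) ∧
      (∀ t : ℤ, IsMonogenicPoly (quartic4T3 t) ↔ Squarefree ((6 * t - 1) * (6 * t + 1))) ∧
      IsInfiniteFamilyOfMonogenicQuartics Group4T3 quartic4T3
        {t : ℤ | Squarefree (36 * t ^ 2 - 1)}) ∧
    -- X = 4
    ((∀ t : ℤ, (quartic4T4 t).Monic ∧ (quartic4T4 t).natDegree = 4 ∧
        Irreducible ((quartic4T4 t).map (Int.castRingHom ℚ)) ∧
        Nonempty (GaloisGroupOverQ (quartic4T4 t) ≃* Group4T4)) ∧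
      (∀ t : ℤ, IsMonogenicPoly (quartic4T4 t) ↔
        Squarefree ((4 * t - 1) * (108 * t ^ 2 - 54 * t + 7))) ∧
      IsInfiniteFamilyOfMonogenicQuartics Group4T4 quartic4T4
        {t : ℤ | Squarefree ((4 * t - 1) * (108 * t ^ 2 - 54 * t + 7))}) ∧
    -- X = 5
    ((∀ t : ℤ, (quartic4T5 t).Monic ∧ (quartic4T5 t).natDegree = 4 ∧
        Irreducible ((quartic4T5 t).map (Int.castRingHom ℚ)) ∧
        Nonempty (GaloisGroupOverQ (quartic4T5 t) ≃* Group4T5)) ∧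
      (∀ t : ℤ, IsMonogenicPoly (quartic4T5 t) ↔
        (Squarefree (4 * t + 1) ∧ Squarefree (4 * t - 7) ∧ Squarefree (64 * t + 13))) ∧
      IsInfiniteFamilyOfMonogenicQuartics Group4T5 quartic4T5
        {t : ℤ | Squarefree (4 * t + 1) ∧ Squarefree (4 * t - 7) ∧
          Squarefree (64 * t + 13)}) := by
  refine ⟨?_, ?_, ?_, ?_⟩
  · exact ⟨fun t => ⟨quartic4T2_eq t ▸ quartic_monic _ _ _ _,
      quartic4T2_eq t ▸ quartic_natDegree _ _ _ _, quartic4T2_irreducible t, quartic4T2_gal t⟩,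
      quartic4T2_isMonogenicPoly_iff, quartic4T2_family⟩
  · exact ⟨fun t => ⟨quartic4T3_eq t ▸ quartic_monic _ _ _ _,
      quartic4T3_eq t ▸ quartic_natDegree _ _ _ _, quartic4T3_irreducible t, quartic4T3_gal t⟩,
      quartic4T3_isMonogenicPoly_iff, quartic4T3_family⟩
  · exact ⟨fun t => ⟨quartic4T4_eq t ▸ quartic_monic _ _ _ _,
      quartic4T4_eq t ▸ quartic_natDegree _ _ _ _, quartic4T4_irreducible t, quartic4T4_gal t⟩,
      quartic4T4_isMonogenicPoly_iff, quartic4T4_family⟩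
  · exact ⟨fun t => ⟨quartic4T5_eq t ▸ quartic_monic _ _ _ _,
      quartic4T5_eq t ▸ quartic_natDegree _ _ _ _, quartic4T5_irreducible t, quartic4T5_gal t⟩,
      quartic4T5_isMonogenicPoly_iff, quartic4T5_family⟩
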